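/- **Notation.** Let $K\subset\mathbb R^3$ be a nondegenerate closed tetrahedron with vertices $x_1,\dots,x_4$, barycenter $x_K$, barycentric coordinates $\lambda_i$ and unit outward normal $\boldsymbol n_i$ on the face $\{\lambda_i=0\}$. Let $K^r$ be its Alfeld split (the four tetrahedra obtained by replacing one vertex by $x_K$), let $P_m(K)$ be the polynomials of degree at most $m$ and $\boldsymbol P_m(K)=[P_m(K)]^3$, and put $$\boldsymbol P^c_m(K^r)=\{\boldsymbol v\in[H^1(K)]^3:\ \boldsymbol v|_T\in\boldsymbol P_m(T)\ \ \forall T\in K^r\},\qquad \mathring{\boldsymbol P}^c_m(K^r)=\boldsymbol P^c_m(K^r)\cap[H^1_0(K)]^3 .$$ *Face bubbles.* $\boldsymbol\beta_1^0,\dots,\boldsymbol\beta_4^0\in\boldsymbol P_3^c(K^r)$ are any fields with $\boldsymbol\beta_i^0|_{\partial K}=\big(\prod_{j\ne i}\lambda_j\big)\boldsymbol n_i|_{\partial K}$ and $\nabla\cdot\boldsymbol\beta_i^0$ constant. *Interior bubbles.* Let $\mathcal H_m(K)$ be the polynomials that are homogeneous of degree $m$ in $x-x_K$, let $\mathcal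 S_1(K)=\mathcal H_1(K)$, $\mathcal S_m(K)=\mathcal H_m(K)\oplus\mathcal H_{m-1}(K)$ for $m\ge2$, and $\mathring{\mathcal S}_m(K)=\{u-\frac1{|K|}\int_K u:\ u\in\mathcal S_m(K)\}$. For $k\ge2$, a bubble space $\mathring B^k(K)$ is the span of any fields in $\mathring{\boldsymbol P}^c_k(K^r)$ whose divergences form a basis of $\mathring{\mathcal S}_{k-1}(K)$. *Velocity space.* $\boldsymbol\Sigma_h^{+,k}(K)$ is $\boldsymbol P_1(K)+\operatorname{span}\{\boldsymbol\beta_i^0\}$ for $k=1$, $\boldsymbol P_2(K)+\operatorname{span}\{\boldsymbol\beta_i^0\}+\mathring B^2(K)$ for $k=2$, and $\boldsymbol P_k(K)+\mathring B^k(K)$ for $k\ge3$. **Lemma.** Let $k\ge1$, and let a bubble space $\mathring B^k(K)$ be chosen for every tetrahedron $K$ (if $k\ge2$). 1. For every $K$ there is a constant $C$ such that for every choice of the face bubbles on $K$ and every $q\in P_{k-1}(K)$ with $\int_Kq=0$ there is $\boldsymbol v\in\boldsymbol\Sigma_h^{+,k}(K)\cap[H_0^1(K)]^3$ with $$\nabla\cdot\boldsymbol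 v=q\quad\text{and}\quad \|\boldsymbol v\|_{1,K}\le C\|q\|_{K}.$$ 2. Suppose that the interior bubbles of different elements correspond to each other under affine maps: whenever $F$ is the affine map taking the (numbered) vertices of $K$ to those of $K'$, with linear part $A$, the Piola transform $\boldsymbol v\mapsto|\det A|^{-1}A\,\boldsymbol v\circ F^{-1}$ maps $\mathring B^k(K)$ into $\mathring B^k(K')$ (so all bubble spaces come from that of one reference element). Then the constant in 1 is independent of $h_K=\operatorname{diam}K$: for every bounded set $\Omega$ and every $\sigma$ one $C$ serves for all tetrahedra $K\subset\overline\Omega$ that are shape regular with parameter $\sigma$, i.e. contain a ball of diameter at least $h_K/\sigma$. -/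

import Mathlib

open MeasureTheory Topology Filter
open scoped ContDiff

noncomputable section

namespace StokesFE

/-- Three-dimensional Euclidean space. -/
abbrev E3 : Type := EuclideanSpace ℝ (Fin 3)

/-! ### Sobolev spaces of vector fields on an open set -/

/-- Scalar test functions: smooth functions with compact support inside `D`. -/
def IsTestFunction (D : Set E3) (φ : E3 → ℝ) : Prop :=
  ContDiff ℝ ∞ φ ∧ HasCompactSupport φ ∧ tsupport φ ⊆ D

/-- The classical partial derivative in the `j`-th coordinate direction. -/
def partialDeriv (j : Fin 3) (φ : E3 → ℝ) (x : E3) : ℝ :=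
  fderiv ℝ φ x (EuclideanSpace.single j 1)

/-- `G` is a weak Jacobian of the field `v` on `D` with square-integrable entries:
`G x i j` is the weak derivative of the `i`-th component in the `j`-th direction. -/
def IsWeakJacobian (D : Set E3) (v : E3 → E3) (G : E3 → Fin 3 → Fin 3 → ℝ) : Prop :=
  (∀ i j, MemLp (fun x => G x i j) 2 (volume.restrict D)) ∧
    ∀ i j, ∀ φ : E3 → ℝ, IsTestFunction D φ →
      ∫ x in D, v x i * partialDeriv j φ x = -∫ x in D, G x i j * φ x

/-- The space `[H¹(D)]³`. -/
def MemH1 (D : Set E3) (v : E3 → E3) : Prop :=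
  MemLp v 2 (volume.restrict D) ∧ ∃ G, IsWeakJacobian D v G

open Classical in
/-- The weak Jacobian of `v` on `D` (unique up to null sets; `0` if `v` has none). -/
def weakJacobian (D : Set E3) (v : E3 → E3) : E3 → Fin 3 → Fin 3 → ℝ :=
  if h : ∃ G, IsWeakJacobian D v G then h.choose else 0

/-- The weak divergence, meaningful for fields in `[H¹(D)]³`. -/
def weakDiv (D : Set E3) (v : E3 → E3) (x : E3) : ℝ :=
  ∑ i, weakJacobian D v x i i

/-- The full norm of `[H¹(D)]³`. -/
def h1Norm (D : Set E3) (v : E3 → E3) : ℝ :=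
  Real.sqrt ((∫ x in D, ∑ i, (v x i) ^ 2) +
    ∫ x in D, ∑ i, ∑ j, (weakJacobian D v x i j) ^ 2)

/-- The norm of `L²(D)`. -/
def l2Norm (D : Set E3) (q : E3 → ℝ) : ℝ :=
  Real.sqrt (∫ x in D, (q x) ^ 2)

/-- The space `[H¹₀(D)]³`: the closure of the compactly supported smooth fields in
`[H¹(D)]³`. -/
def MemH10 (D : Set E3) (v : E3 → E3) : Prop :=
  MemH1 D v ∧ ∃ φ : ℕ → E3 → E3,
    (∀ n, ContDiff ℝ ∞ (φ n) ∧ HasCompactSupport (φ n) ∧ tsupport (φ n) ⊆ D) ∧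
      Tendsto (fun n => h1Norm D (v - φ n)) atTop (𝓝 0)

/-! ### Polynomial spaces -/

/-- Evaluation of polynomials in the coordinates centred at `a`. -/
def polyFun (a : E3) : MvPolynomial (Fin 3) ℝ →ₗ[ℝ] (E3 → ℝ) where
  toFun p := fun x => MvPolynomial.eval (fun i => x i - a i) p
  map_add' p q := by ext x; simp
  map_smul' c p := by ext x; simp [MvPolynomial.smul_eval]

/-- Polynomial functions of degree at most `k`. -/
def polySpace (k : ℕ) : Submodule ℝ (E3 → ℝ) :=
  (MvPolynomial.restrictTotalDegree (Fin 3) ℝ k).map (polyFun 0)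

/-- Polynomial functions that are homogeneous of degree `m` in the coordinates centred
at `a`. -/
def homSpace (a : E3) (m : ℕ) : Submodule ℝ (E3 → ℝ) :=
  (MvPolynomial.homogeneousSubmodule (Fin 3) ℝ m).map (polyFun a)

/-- Polynomial vector fields of degree at most `k`. -/
def vecPolySpace (k : ℕ) : Submodule ℝ (E3 → E3) where
  carrier := {v | ∀ i, (fun x => v x i) ∈ polySpace k}
  add_mem' hu hv i := (polySpace k).add_mem (hu i) (hv i)
  zero_mem' _ := (polySpace k).zero_mem
  smul_mem' c _ hv i := (polySpace k).smul_mem c (hv i)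

/-! ### Tetrahedra -/

/-- A nondegenerate tetrahedron, given by its numbered vertices. -/
abbrev Tet : Type := Affine.Simplex ℝ E3 3

/-- The closed tetrahedron. -/
def body (K : Tet) : Set E3 := convexHull ℝ (Set.range K.points)

/-- The open tetrahedron. -/
def dom (K : Tet) : Set E3 := interior (body K)

/-- The `i`-th closed tetrahedron of the Alfeld split: the `i`-th vertex is replaced by
the barycenter. -/
def alfeldPiece (K : Tet) (i : Fin 4) : Set E3 :=
  convexHull ℝ (Set.range (Function.update K.points i K.centroid))

/-- Shape regularity with parameter `σ`: the diameter is at most `σ` times the diameter of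
some ball contained in the tetrahedron. -/
def ShapeRegular (σ : ℝ) (K : Tet) : Prop :=
  ∃ (c : E3) (r : ℝ), 0 < r ∧ Metric.closedBall c r ⊆ body K ∧
    Metric.diam (body K) ≤ σ * (2 * r)

/-- The vertices as an affine basis. -/
def affBasis (K : Tet) : AffineBasis (Fin 4) ℝ E3 where
  toFun := K.points
  ind' := K.independent
  tot' := by
    rw [K.independent.affineSpan_eq_top_iff_card_eq_finrank_add_one]
    simp

/-- The barycentric coordinates. -/
def bary (K : Tet) (i : Fin 4) : E3 →ᵃ[ℝ] ℝ := (affBasis K).coord i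

/-- The (constant) gradient of the `i`-th barycentric coordinate. -/
def gradBary (K : Tet) (i : Fin 4) : E3 :=
  (InnerProductSpace.toDual ℝ E3).symm (LinearMap.toContinuousLinearMap (bary K i).linear)

/-- The unit outward normal of the face opposite to the `i`-th vertex, on which the `i`-th
barycentric coordinate vanishes. -/
def outwardNormal (K : Tet) (i : Fin 4) : E3 :=
  -(‖gradBary K i‖⁻¹ • gradBary K i)

/-! ### Spaces on the Alfeld split -/

/-- Continuous piecewise polynomial fields of degree at most `k` on the Alfeld split (each
element of `[H¹(K)]³` that is piecewise polynomial is represented by its continuous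
representative). Only the values on `K` matter. -/
def MemPc (k : ℕ) (K : Tet) (v : E3 → E3) : Prop :=
  MemH1 (dom K) v ∧ ∀ i, ∃ p ∈ vecPolySpace k, ∀ x ∈ alfeldPiece K i, v x = p x

/-- Those with vanishing boundary values. -/
def MemPc0 (k : ℕ) (K : Tet) (v : E3 → E3) : Prop :=
  MemPc k K v ∧ MemH10 (dom K) v

/-! ### Modified face bubbles -/

/-- The Bernardi–Raugel face bubble: the product of the barycentric coordinates other than
the `i`-th one, times the unit normal of the `i`-th face. -/
def brBubble (K : Tet) (i : Fin 4) (x : E3) : E3 :=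
  (∏ j ∈ Finset.univ.erase i, bary K j x) • outwardNormal K i

/-- `β` is an admissible choice of the four modified face bubbles on `K`. -/
def IsFaceBubbles (K : Tet) (β : Fin 4 → E3 → E3) : Prop :=
  ∀ i, MemPc 3 K (β i) ∧ (∀ x ∈ frontier (body K), β i x = brBubble K i x) ∧
    ∃ c : ℝ, ∀ᵐ x ∂(volume.restrict (dom K)), weakDiv (dom K) (β i) x = c

/-! ### Interior bubbles -/

/-- The space `S_m(K)`: homogeneous polynomials of degree `m`, together with those of degree
`m - 1` when `m ≥ 2`, where homogeneity refers to coordinates centred at the barycenter. -/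
def sSpace (m : ℕ) (K : Tet) : Submodule ℝ (E3 → ℝ) :=
  if m = 1 then homSpace K.centroid 1
  else homSpace K.centroid m ⊔ homSpace K.centroid (m - 1)

/-- The mean-value-free version of `S_m(K)`. -/
def sRing (m : ℕ) (K : Tet) : Set (E3 → ℝ) :=
  {g | ∃ u ∈ sSpace m K, g = fun x => u x - ⨍ y in body K, u y}

/-- `B` is an admissible choice of the space of interior bubbles of degree `k ≥ 2` on `K`:
it is spanned by piecewise polynomial fields of degree at most `k` on the Alfeld split with
vanishing boundary values, whose divergences form a basis of the mean-value-free version of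
`S_{k-1}(K)`. -/
def IsInteriorBubbleSpace (k : ℕ) (K : Tet) (B : Submodule ℝ (E3 → E3)) : Prop :=
  ∃ (N : ℕ) (β : Fin N → E3 → E3) (g : Fin N → E3 → ℝ),
    LinearIndependent ℝ g ∧
    (Submodule.span ℝ (Set.range g) : Set (E3 → ℝ)) = sRing (k - 1) K ∧
    (∀ j, MemPc0 k K (β j)) ∧
    (∀ j, ∀ᵐ x ∂(volume.restrict (dom K)), weakDiv (dom K) (β j) x = g j x) ∧
    B = Submodule.span ℝ (Set.range β)

/-- The interior bubble spaces of different elements are obtained from each other (hence all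
from the one of a fixed reference element) by the contravariant Piola transform of the affine
map that matches the vertices. -/
def PiolaCompatible (B : Tet → Submodule ℝ (E3 → E3)) : Prop :=
  ∀ (K K' : Tet) (F : E3 →ᵃ[ℝ] E3), (∀ i, F (K.points i) = K'.points i) →
    ∀ v ∈ B K, ∃ v' ∈ B K', ∀ x ∈ body K,
      v' (F x) = |LinearMap.det F.linear|⁻¹ • F.linear (v x)

/-! ### The local velocity space -/

/-- The local space `Σ_h^{+,k}(K)` built from the face bubbles `β` and the space `B` of
interior bubbles. Only the values on `K` of its elements matter. -/
def velocitySpace (k : ℕ) (β : Fin 4 → E3 → E3) (B : Submodule ℝ (E3 → E3)) :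
    Submodule ℝ (E3 → E3) :=
  if k = 1 then vecPolySpace 1 ⊔ Submodule.span ℝ (Set.range β)
  else if k = 2 then vecPolySpace 2 ⊔ Submodule.span ℝ (Set.range β) ⊔ B
  else vecPolySpace k ⊔ B

/-- On `K`, with the bubbles `β` and `B`, every mean-value-free polynomial of degree at most
`k - 1` is the divergence of a field in `Σ_h^{+,k}(K) ∩ [H¹₀(K)]³` whose norm is bounded with
the constant `C`. -/
def LocallyOnto (k : ℕ) (C : ℝ) (K : Tet) (β : Fin 4 → E3 → E3)
    (B : Submodule ℝ (E3 → E3)) : Prop :=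
  ∀ q ∈ polySpace (k - 1), ∫ x in body K, q x = 0 →
    ∃ v ∈ velocitySpace k β B, MemH10 (dom K) v ∧
      (∀ᵐ x ∂(volume.restrict (dom K)), weakDiv (dom K) v x = q x) ∧
      h1Norm (dom K) v ≤ C * l2Norm (dom K) q

end StokesFE

end

/-!
# Surjectivity of the divergence on a tetrahedron with interior bubbles

For `k = 1` the mean value condition forces `q = 0`. For `k ≥ 2` the face bubbles play no role:
every `q` of degree at most `k - 1` with vanishing mean is the divergence of a polynomial field
`b w` of degree at most `k`, where `b = λ₁ λ₂ λ₃ λ₄`, plus an element of the interior bubble space.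

Since the divergences of the interior bubbles exhaust, up to constants, the homogeneous polynomials
of the two top degrees in `x - x_K`, the algebraic heart is `mem_attainable_of_totalDegree_le`:
modulo constants and homogeneous polynomials of degrees `k - 1` and `k - 2`, every polynomial of
degree at most `k - 1` is some `div (b w)`. This is affinely invariant through the Piola transform,
so it suffices to treat the regular tetrahedron inscribed in the cube `[-1, 1]³`, where `256 b` is
`1 - 2 |x|²` plus a cubic and a quartic term. By descending induction on the degree `m`, modulo the
degrees already attained, `div (b w)` sees only the radial part of `b`. A field that is divergence
free and tangential to spheres then shows that the attainable polynomials of degree `m` are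
invariant under infinitesimal rotations (`rotation_mem_attainable`). Homogeneous polynomials modulo
such rotations are multiples of `y ^ m`, which is itself a rotation for odd `m`; for even `m`, one
explicit field each produces a nonzero multiple of `y ^ m` (`X1_pow_two_mem_attainable`,
`X1_pow_four_mem_attainable`, `X1_pow_mem_attainable_add_four`), the cubic and quartic terms
of `b` contributing only to degrees already attained.

The additive constant left over is zero because all the fields involved have vanishing boundary
values, so that their divergences have mean zero (`MemH10.integral_weakDiv_eq_zero`); that
polynomial bubble fields lie in `H¹₀` follows by cutting off near the boundary
(`memH10_smul_of_frontier`).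

On one element, the bound by the `L²` norm comes from finite dimensionality: choose fields for a
basis of the polynomials with vanishing mean (`exists_weakDiv_eq_h1Norm_le`). Under the Piola
compatibility of the interior bubbles, the fields of the regular tetrahedron transfer to every
other tetrahedron. The transformation factors are controlled by the entries of the linear part `A`
and of its inverse, hence by the diameter and the inradius (`abs_entry_le`, `h1Norm_piola_sq_le`),
and shape regularity together with boundedness of the domain makes the constant uniform
(`exists_uniform_weakDiv_eq_h1Norm_le`).
-/

namespace StokesFE

/-! ### Divergences of bubble fields modulo polynomials of the two top degrees -/

section Algebra

open MvPolynomial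

/-- The cubic part of `256 λ₁λ₂λ₃λ₄` in the coordinates of the regular tetrahedron. -/
noncomputable def bubbleCubic : MvPolynomial (Fin 3) ℝ := 8 * (X 0 * X 1 * X 2)

/-- The quadratic form `|x|²`. -/
noncomputable def normSq : MvPolynomial (Fin 3) ℝ := X 0 ^ 2 + X 1 ^ 2 + X 2 ^ 2

/-- The quartic part of `256 λ₁λ₂λ₃λ₄` in the coordinates of the regular tetrahedron. -/
noncomputable def bubbleQuartic : MvPolynomial (Fin 3) ℝ :=
  X 0 ^ 4 + X 1 ^ 4 + X 2 ^ 4 - 2 * (X 0 ^ 2 * X 1 ^ 2 + X 1 ^ 2 * X 2 ^ 2 + X 2 ^ 2 * X 0 ^ 2)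

/-- The polynomial `256 λ₁λ₂λ₃λ₄` for the regular tetrahedron with vertices `(1,1,1)`,
`(1,-1,-1)`, `(-1,1,-1)`, `(-1,-1,1)`. It has no linear part and a radial quadratic part. -/
noncomputable def bubblePoly : MvPolynomial (Fin 3) ℝ :=
  1 - 2 * normSq + bubbleCubic + bubbleQuartic

lemma isHomogeneous_monom (a b c : ℕ) :
    (X 0 ^ a * X 1 ^ b * X 2 ^ c : MvPolynomial (Fin 3) ℝ).IsHomogeneous (a + b + c) :=
  ((isHomogeneous_X_pow 0 a).mul (isHomogeneous_X_pow 1 b)).mul (isHomogeneous_X_pow 2 c)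

lemma isHomogeneous_const_mul_monom {n : ℕ} (r : ℝ) (a b c : ℕ) (h : a + b + c = n) :
    (C r * (X 0 ^ a * X 1 ^ b * X 2 ^ c) : MvPolynomial (Fin 3) ℝ).IsHomogeneous n :=
  h ▸ (isHomogeneous_monom a b c).C_mul r

lemma isHomogeneous_normSq : normSq.IsHomogeneous 2 :=
  ((isHomogeneous_X_pow 0 2).add (isHomogeneous_X_pow 1 2)).add (isHomogeneous_X_pow 2 2)

lemma isHomogeneous_bubbleCubic : bubbleCubic.IsHomogeneous 3 := by
  have := isHomogeneous_const_mul_monom 8 1 1 1 rfl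
  simpa [bubbleCubic, map_ofNat] using this

lemma isHomogeneous_bubbleQuartic : bubbleQuartic.IsHomogeneous 4 := by
  have h : ∀ i j : Fin 3, (X i ^ 2 * X j ^ 2 : MvPolynomial (Fin 3) ℝ).IsHomogeneous 4 :=
    fun i j => (isHomogeneous_X_pow i 2).mul (isHomogeneous_X_pow j 2)
  have h2 := (((h 0 1).add (h 1 2)).add (h 2 0)).C_mul 2
  rw [map_ofNat] at h2
  exact (((isHomogeneous_X_pow 0 4).add (isHomogeneous_X_pow 1 4)).add
    (isHomogeneous_X_pow 2 4)).sub h2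

lemma pderiv_comm (i j : Fin 3) (p : MvPolynomial (Fin 3) ℝ) :
    pderiv i (pderiv j p) = pderiv j (pderiv i p) := by
  ext m
  simp only [coeff_pderiv]
  rcases eq_or_ne i j with rfl | h
  · rfl
  · rw [show m + Finsupp.single i 1 + Finsupp.single j 1
      = m + Finsupp.single j 1 + Finsupp.single i 1 by abel]
    simp [h, h.symm]
    ring

lemma pderiv_normSq (i : Fin 3) : pderiv i normSq = 2 * X i := by
  fin_cases i <;> simp [normSq]

lemma pderiv_bubblePoly (i : Fin 3) :
    pderiv i bubblePoly = -(4 * X i) + pderiv i bubbleCubic + pderiv i bubbleQuartic := by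
  have h2 : pderiv i (2 : MvPolynomial (Fin 3) ℝ) = 0 := by
    rw [show (2 : MvPolynomial (Fin 3) ℝ) = C 2 from (map_ofNat C 2).symm]; exact pderiv_C
  simp only [bubblePoly, map_add, map_sub, pderiv_one, pderiv_mul, pderiv_normSq, h2]
  ring

/-- The polynomials that are a combination of divergences `∂ᵢ (bubblePoly * p)` with
`deg p ≤ M - 3`, homogeneous polynomials of degrees `M` and `M - 1`, and constants. -/
noncomputable def attainable (M : ℕ) : Submodule ℝ (MvPolynomial (Fin 3) ℝ) :=
  Submodule.span ℝ {q | ∃ (i : Fin 3) (p : MvPolynomial (Fin 3) ℝ),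
      p.totalDegree ≤ M - 3 ∧ q = pderiv i (bubblePoly * p)} ⊔
    (homogeneousSubmodule (Fin 3) ℝ M ⊔ homogeneousSubmodule (Fin 3) ℝ (M - 1)) ⊔
    Submodule.span ℝ {1}

/-- All homogeneous polynomials of degree larger than `m` and at most `M` are attainable. -/
def AttainableAbove (M m : ℕ) : Prop :=
  ∀ j, m < j → j ≤ M → ∀ p : MvPolynomial (Fin 3) ℝ, p.IsHomogeneous j → p ∈ attainable M

variable {M m : ℕ}

lemma pderiv_mul_mem_attainable (i : Fin 3) {p : MvPolynomial (Fin 3) ℝ}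
    (hp : p.totalDegree ≤ M - 3) : pderiv i (bubblePoly * p) ∈ attainable M :=
  Submodule.mem_sup_left (Submodule.mem_sup_left (Submodule.subset_span ⟨i, p, hp, rfl⟩))

lemma pderiv_mul_mem_attainable_of_isHomogeneous {d : ℕ} (i : Fin 3)
    {p : MvPolynomial (Fin 3) ℝ} (hp : p.IsHomogeneous d) (hd : d ≤ M - 3) :
    pderiv i (bubblePoly * p) ∈ attainable M :=
  pderiv_mul_mem_attainable i (hp.totalDegree_le.trans hd)

lemma C_mem_attainable (r : ℝ) : C r ∈ attainable M := by
  refine Submodule.mem_sup_right (Submodule.mem_span_singleton.2 ⟨r, ?_⟩)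
  rw [smul_eq_C_mul, mul_one]

lemma mem_attainable_of_C_mul {r : ℝ} (hr : r ≠ 0) {p : MvPolynomial (Fin 3) ℝ}
    (h : C r * p ∈ attainable M) : p ∈ attainable M := by
  have := (attainable M).smul_mem r⁻¹ h
  rwa [smul_eq_C_mul, ← mul_assoc, ← C_mul, inv_mul_cancel₀ hr, C_1, one_mul] at this

/-- Modulo attainable polynomials, homogeneous polynomials are invariant under infinitesimal
rotations: the field `(∂ⱼc) eᵢ - (∂ᵢc) eⱼ` is divergence free. -/
lemma rotation_mem_attainable (hm : 1 ≤ m) (hM : m + 2 ≤ M) (h : AttainableAbove M m)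
    (i j : Fin 3) {c : MvPolynomial (Fin 3) ℝ} (hc : c.IsHomogeneous m) :
    X i * pderiv j c - X j * pderiv i c ∈ attainable M := by
  have h1 := pderiv_mul_mem_attainable_of_isHomogeneous (M := M) i (hc.pderiv (i := j)) (by omega)
  have h2 := pderiv_mul_mem_attainable_of_isHomogeneous (M := M) j (hc.pderiv (i := i)) (by omega)
  have h3 : pderiv i bubbleCubic * pderiv j c - pderiv j bubbleCubic * pderiv i c ∈
      attainable M := by
    have h0 : ∀ i j : Fin 3, (pderiv i bubbleCubic * pderiv j c).IsHomogeneous (m + 1) := by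
      intro i j
      convert (isHomogeneous_bubbleCubic.pderiv (i := i)).mul (hc.pderiv (i := j)) using 1
      omega
    exact h (m + 1) (by omega) (by omega) _ ((h0 i j).sub (h0 j i))
  have h4 : pderiv i bubbleQuartic * pderiv j c - pderiv j bubbleQuartic * pderiv i c ∈
      attainable M := by
    have h0 : ∀ i j : Fin 3, (pderiv i bubbleQuartic * pderiv j c).IsHomogeneous (m + 2) := by
      intro i j
      convert (isHomogeneous_bubbleQuartic.pderiv (i := i)).mul (hc.pderiv (i := j)) using 1
      omega
    exact h (m + 2) (by omega) (by omega) _ ((h0 i j).sub (h0 j i))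
  have h5 := sub_mem (add_mem h3 h4) (sub_mem h1 h2)
  refine mem_attainable_of_C_mul (r := 4) (by norm_num) ?_
  convert h5 using 1
  simp only [pderiv_mul, pderiv_bubblePoly, pderiv_comm i j, map_ofNat]
  ring

/-- Rotation in the plane of the first two coordinates, for monomials. -/
lemma rotation_monom₀₁ (hM : m + 2 ≤ M) (h : AttainableAbove M m) {a b e : ℕ}
    (hm : a + b + e + 2 = m) :
    C ((b : ℝ) + 1) * (X 0 ^ (a + 2) * X 1 ^ b * X 2 ^ e) -
      C ((a : ℝ) + 1) * (X 0 ^ a * X 1 ^ (b + 2) * X 2 ^ e) ∈ attainable M := by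
  have hc : (X 0 ^ (a + 1) * X 1 ^ (b + 1) * X 2 ^ e : MvPolynomial (Fin 3) ℝ).IsHomogeneous m := by
    convert isHomogeneous_monom (a + 1) (b + 1) e using 1; omega
  have := rotation_mem_attainable (by omega) hM h 0 1 hc
  convert this using 1
  simp
  ring

/-- Rotation in the plane of the last two coordinates, for monomials. -/
lemma rotation_monom₁₂ (hM : m + 2 ≤ M) (h : AttainableAbove M m) {a b e : ℕ}
    (hm : a + b + e + 2 = m) :
    C ((b : ℝ) + 1) * (X 0 ^ a * X 1 ^ b * X 2 ^ (e + 2)) -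
      C ((e : ℝ) + 1) * (X 0 ^ a * X 1 ^ (b + 2) * X 2 ^ e) ∈ attainable M := by
  have hc : (X 0 ^ a * X 1 ^ (b + 1) * X 2 ^ (e + 1) : MvPolynomial (Fin 3) ℝ).IsHomogeneous m := by
    convert isHomogeneous_monom a (b + 1) (e + 1) using 1; omega
  have := rotation_mem_attainable (by omega) hM h 2 1 hc
  convert this using 1
  simp
  ring

lemma X0_mul_mem_attainable (hM : m + 2 ≤ M) (h : AttainableAbove M m) {b e : ℕ}
    (hm : b + e + 1 = m) : X 0 * X 1 ^ b * X 2 ^ e ∈ attainable M := by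
  have hc : (X 0 ^ 0 * X 1 ^ (b + 1) * X 2 ^ e : MvPolynomial (Fin 3) ℝ).IsHomogeneous m := by
    convert isHomogeneous_monom 0 (b + 1) e using 1; omega
  have := rotation_mem_attainable (by omega) hM h 0 1 hc
  refine mem_attainable_of_C_mul (r := (b : ℝ) + 1) (by positivity) ?_
  convert this using 1
  simp
  ring

lemma X2_mul_mem_attainable (hM : m + 2 ≤ M) (h : AttainableAbove M m) {b : ℕ}
    (hm : b + 1 = m) : X 1 ^ b * X 2 ∈ attainable M := by
  have hc : (X 1 ^ (b + 1) : MvPolynomial (Fin 3) ℝ).IsHomogeneous m := hm ▸ isHomogeneous_X_pow 1 _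
  have := rotation_mem_attainable (by omega) hM h 2 1 hc
  refine mem_attainable_of_C_mul (r := (b : ℝ) + 1) (by positivity) ?_
  convert this using 1
  simp
  ring

/-- By rotation invariance, every homogeneous polynomial of degree `m` is attainable as soon as
the power `X 1 ^ m` is. -/
lemma isHomogeneous_mem_attainable (hM : m + 2 ≤ M) (h : AttainableAbove M m)
    (hX : X 1 ^ m ∈ attainable M) {p : MvPolynomial (Fin 3) ℝ} (hp : p.IsHomogeneous m) :
    p ∈ attainable M := by
  have key₂ : ∀ e b : ℕ, b + e = m → X 1 ^ b * X 2 ^ e ∈ attainable M := by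
    intro e
    induction e using Nat.twoStepInduction with
    | zero => rintro b rfl; simpa using hX
    | one => intro b hb; simpa using X2_mul_mem_attainable hM h hb
    | more e ih _ =>
      intro b hb
      have h1 := rotation_monom₁₂ hM h (a := 0) (b := b) (e := e) (by omega)
      have h2 := (attainable M).smul_mem ((e : ℝ) + 1) (ih (b + 2) (by omega))
      refine mem_attainable_of_C_mul (r := (b : ℝ) + 1) (by positivity) ?_
      convert add_mem h1 h2 using 1
      rw [smul_eq_C_mul]; ring
  have key : ∀ a b e : ℕ, a + b + e = m → X 0 ^ a * X 1 ^ b * X 2 ^ e ∈ attainable M := by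
    intro a
    induction a using Nat.twoStepInduction with
    | zero => intro b e he; simpa using key₂ e b (by omega)
    | one => intro b e he; simpa using X0_mul_mem_attainable hM h (b := b) (e := e) (by omega)
    | more a ih _ =>
      intro b e he
      have h1 := rotation_monom₀₁ hM h (a := a) (b := b) (e := e) (by omega)
      have h2 := (attainable M).smul_mem ((a : ℝ) + 1) (ih (b + 2) e (by omega))
      refine mem_attainable_of_C_mul (r := (b : ℝ) + 1) (by positivity) ?_
      convert add_mem h1 h2 using 1
      rw [smul_eq_C_mul]; ring
  rw [p.as_sum]
  refine sum_mem fun d hd => ?_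
  have hdeg : d 0 + d 1 + d 2 = m := by
    have := hp (mem_support_iff.1 hd)
    rw [← this, Finsupp.weight_apply, Finsupp.sum_fintype _ _ (by simp)]
    simp [Fin.sum_univ_three]
  have hmon : monomial d (coeff d p) = (coeff d p) • (X 0 ^ d 0 * X 1 ^ d 1 * X 2 ^ d 2) := by
    rw [smul_eq_C_mul, monomial_eq, Finsupp.prod_fintype _ _ (by simp), Fin.prod_univ_three]
  rw [hmon]
  exact (attainable M).smul_mem _ (key _ _ _ hdeg)

/-- In odd degrees rotation invariance alone suffices: an odd power is reached from
`X 0 ^ (m - 1) * X 1`. -/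
lemma X1_pow_mem_attainable_of_odd (hM : m + 2 ≤ M) (h : AttainableAbove M m) (hm : Odd m) :
    X 1 ^ m ∈ attainable M := by
  have key : ∀ j a : ℕ, a + (2 * j + 1) = m → X 0 ^ a * X 1 ^ (2 * j + 1) ∈ attainable M := by
    intro j
    induction j with
    | zero =>
      intro a ha
      have hc : (X 0 ^ (a + 1) : MvPolynomial (Fin 3) ℝ).IsHomogeneous m := by
        convert isHomogeneous_X_pow (R := ℝ) (0 : Fin 3) (a + 1) using 1; omega
      have := rotation_mem_attainable (by omega) hM h 1 0 hc
      refine mem_attainable_of_C_mul (r := (a : ℝ) + 1) (by positivity) ?_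
      convert this using 1
      simp
      ring
    | succ j ih =>
      intro a ha
      have h1 := rotation_monom₀₁ hM h (a := a) (b := 2 * j + 1) (e := 0) (by omega)
      have h2 := (attainable M).smul_mem (((2 * j + 1 : ℕ) : ℝ) + 1) (ih (a + 2) (by omega))
      refine mem_attainable_of_C_mul (r := (a : ℝ) + 1) (by positivity) ?_
      convert sub_mem h2 h1 using 1
      rw [smul_eq_C_mul, show 2 * (j + 1) + 1 = 2 * j + 1 + 2 by ring]; ring
  obtain ⟨j, rfl⟩ := hm
  simpa using key j 0 (by omega)

end Algebra

section Algebra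

open MvPolynomial

variable {M m : ℕ}

lemma isHomogeneous_pderiv_bubbleQuartic_mul (i : Fin 3) {d : ℕ} {p : MvPolynomial (Fin 3) ℝ}
    (hp : p.IsHomogeneous d) : (pderiv i bubbleQuartic * p).IsHomogeneous (d + 3) := by
  convert (isHomogeneous_bubbleQuartic.pderiv (i := i)).mul hp using 1; omega

lemma pderiv_bubbleCubic :
    pderiv 0 bubbleCubic = 8 * (X 1 * X 2) ∧ pderiv 1 bubbleCubic = 8 * (X 0 * X 2) ∧
      pderiv 2 bubbleCubic = 8 * (X 0 * X 1) := by
  have h : bubbleCubic = C 8 * (X 0 * X 1 * X 2) := by simp [bubbleCubic, map_ofNat]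
  refine ⟨?_, ?_, ?_⟩ <;> (rw [h, pderiv_C_mul, map_ofNat]; simp; try ring)

lemma pderiv_bubbleQuartic :
    pderiv 0 bubbleQuartic = 4 * X 0 * (X 0 ^ 2 - X 1 ^ 2 - X 2 ^ 2) ∧
    pderiv 1 bubbleQuartic = 4 * X 1 * (X 1 ^ 2 - X 0 ^ 2 - X 2 ^ 2) ∧
    pderiv 2 bubbleQuartic = 4 * X 2 * (X 2 ^ 2 - X 0 ^ 2 - X 1 ^ 2) := by
  have h : bubbleQuartic = X 0 ^ 4 + X 1 ^ 4 + X 2 ^ 4 -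
      C 2 * (X 0 ^ 2 * X 1 ^ 2 + X 1 ^ 2 * X 2 ^ 2 + X 2 ^ 2 * X 0 ^ 2) := by
    simp [bubbleQuartic, map_ofNat]
  refine ⟨?_, ?_, ?_⟩ <;> (rw [h, map_sub, pderiv_C_mul, map_ofNat]; simp; ring)

/-- The divergence of `bubblePoly` times the position vector has the quadratic part `-10 |x|²`. -/
lemma X1_pow_two_mem_attainable (hM : 4 ≤ M) (h : AttainableAbove M 2) :
    X 1 ^ 2 ∈ attainable M := by
  have hW : ∀ i : Fin 3, pderiv i (bubblePoly * X i) ∈ attainable M := fun i =>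
    pderiv_mul_mem_attainable_of_isHomogeneous i (isHomogeneous_X ℝ i) (by omega)
  have h3 := h 3 (by omega) (by omega) _ (isHomogeneous_bubbleCubic.C_mul 6)
  have h4 := h 4 (by omega) (by omega) _ (isHomogeneous_bubbleQuartic.C_mul 7)
  have r1 := rotation_monom₀₁ (by omega) h (a := 0) (b := 0) (e := 0) rfl
  have r2 := rotation_monom₁₂ (by omega) h (a := 0) (b := 0) (e := 0) rfl
  have hsum := sub_mem (sub_mem (add_mem (add_mem (C_mem_attainable (M := M) 3) h3) h4)
    (add_mem (add_mem (hW 0) (hW 1)) (hW 2)))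
    ((attainable M).smul_mem 10 (add_mem r1 r2))
  refine mem_attainable_of_C_mul (r := 30) (by norm_num) ?_
  convert hsum using 1
  simp only [pderiv_mul, pderiv_bubblePoly, pderiv_bubbleCubic, pderiv_bubbleQuartic,
    pderiv_X_self, smul_eq_C_mul]
  simp [bubblePoly, normSq, bubbleCubic, bubbleQuartic, map_ofNat]
  ring

/-- For `m = 4` the relation comes from the field `(1 + 2 |x|²) x + 12 (yz, 0, 0)`: the terms of
degrees two and three of the divergence of its product with `bubblePoly` cancel. -/
lemma X1_pow_four_mem_attainable (hM : 6 ≤ M) (h : AttainableAbove M 4) :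
    X 1 ^ 4 ∈ attainable M := by
  have hW : ∀ i : Fin 3, pderiv i (bubblePoly * X i) ∈ attainable M := fun i =>
    pderiv_mul_mem_attainable_of_isHomogeneous i (isHomogeneous_X ℝ i) (by omega)
  have hW' : ∀ i : Fin 3, pderiv i (bubblePoly * (C 2 * (normSq * X i))) ∈ attainable M := fun i =>
    pderiv_mul_mem_attainable_of_isHomogeneous i
      ((isHomogeneous_normSq.mul (isHomogeneous_X ℝ i)).C_mul 2) (by omega)
  have hW'' : pderiv 0 (bubblePoly * (C 12 * (X 0 ^ 0 * X 1 ^ 1 * X 2 ^ 1))) ∈ attainable M :=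
    pderiv_mul_mem_attainable_of_isHomogeneous 0 (isHomogeneous_const_mul_monom 12 0 1 1 rfl)
      (by omega)
  have h5 := h 5 (by omega) (by omega) _
    ((isHomogeneous_normSq.mul isHomogeneous_bubbleCubic).C_mul 16)
  have h5' := h 5 (by omega) (by omega) _ (isHomogeneous_pderiv_bubbleQuartic_mul 0
    (isHomogeneous_const_mul_monom 12 0 1 1 rfl))
  have h6 := h 6 (by omega) (by omega) _
    ((isHomogeneous_normSq.mul isHomogeneous_bubbleQuartic).C_mul 18)
  have r1 := rotation_monom₀₁ (by omega) h (a := 2) (b := 0) (e := 0) rfl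
  have r2 := rotation_monom₀₁ (by omega) h (a := 0) (b := 2) (e := 0) rfl
  have r3 := rotation_monom₁₂ (by omega) h (a := 0) (b := 0) (e := 2) rfl
  have r4 := rotation_monom₁₂ (by omega) h (a := 0) (b := 2) (e := 0) rfl
  have r5 := rotation_monom₀₁ (by omega) h (a := 0) (b := 0) (e := 2) rfl
  have hdiv := add_mem (add_mem (add_mem (add_mem (hW 0) (hW 1)) (hW 2))
    (add_mem (add_mem (hW' 0) (hW' 1)) (hW' 2))) hW''
  have hhigh := add_mem (add_mem h5 h5') h6
  have hrot := add_mem (add_mem (add_mem (add_mem ((attainable M).smul_mem 63 r1)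
    ((attainable M).smul_mem 133 r2)) ((attainable M).smul_mem 63 r3))
    ((attainable M).smul_mem 107 r4)) ((attainable M).smul_mem 210 r5)
  have hsum := sub_mem ((attainable M).smul_mem 3
    (sub_mem (add_mem (C_mem_attainable (M := M) 3) hhigh) hdiv)) hrot
  refine mem_attainable_of_C_mul (r := 303) (by norm_num) ?_
  convert hsum using 1
  simp only [pderiv_mul, pderiv_bubblePoly, pderiv_bubbleCubic, pderiv_bubbleQuartic,
    pderiv_X_self, smul_eq_C_mul, pderiv_normSq, pderiv_C, pderiv_pow]
  simp [bubblePoly, normSq, bubbleCubic, bubbleQuartic, map_ofNat]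
  ring

/-- For even `m = t + 4 ≥ 6` the relation comes from `(1 + 2 |x|²) p + q` with the divergence-free
fields `p = ((t + 1) x yᵗ, -yᵗ⁺¹, 0)` and `q = (0, 0, 2 t x yᵗ⁺¹)`: in the divergence of its
product with `bubblePoly` all terms of degree less than `m` cancel, and rotation invariance
reduces the part of degree `m` to `8 t / (t + 3)` times `yᵐ`. -/
lemma X1_pow_mem_attainable_add_four {t : ℕ} (ht : 0 < t) (hM : t + 6 ≤ M)
    (h : AttainableAbove M (t + 4)) : X 1 ^ (t + 4) ∈ attainable M := by
  set p₀ : MvPolynomial (Fin 3) ℝ := C ((t : ℝ) + 1) * (X 0 ^ 1 * X 1 ^ t * X 2 ^ 0) with hp₀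
  set p₁ : MvPolynomial (Fin 3) ℝ := C (-1) * (X 0 ^ 0 * X 1 ^ (t + 1) * X 2 ^ 0) with hp₁
  set q : MvPolynomial (Fin 3) ℝ := C (2 * (t : ℝ)) * (X 0 ^ 1 * X 1 ^ (t + 1) * X 2 ^ 0) with hq
  have i₀ : p₀.IsHomogeneous (t + 1) := isHomogeneous_const_mul_monom _ 1 t 0 (by ring)
  have i₁ : p₁.IsHomogeneous (t + 1) := isHomogeneous_const_mul_monom _ 0 (t + 1) 0 (by ring)
  have iq : q.IsHomogeneous (t + 2) := isHomogeneous_const_mul_monom _ 1 (t + 1) 0 (by ring)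
  have iN : ∀ {p : MvPolynomial (Fin 3) ℝ}, p.IsHomogeneous (t + 1) →
      (C 2 * (normSq * p)).IsHomogeneous (t + 3) := fun {p} hp => by
    convert (isHomogeneous_normSq.mul hp).C_mul 2 using 1; ring
  have ix : (X 0 * p₀ + X 1 * p₁).IsHomogeneous (t + 2) := by
    convert ((isHomogeneous_X ℝ 0).mul i₀).add ((isHomogeneous_X ℝ 1).mul i₁) using 1; ring
  have hdiv := add_mem (add_mem
    (add_mem (pderiv_mul_mem_attainable_of_isHomogeneous (M := M) 0 i₀ (by omega))
      (pderiv_mul_mem_attainable_of_isHomogeneous (M := M) 1 i₁ (by omega)))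
    (add_mem (pderiv_mul_mem_attainable_of_isHomogeneous (M := M) 0 (iN i₀) (by omega))
      (pderiv_mul_mem_attainable_of_isHomogeneous (M := M) 1 (iN i₁) (by omega))))
    (pderiv_mul_mem_attainable_of_isHomogeneous (M := M) 2 iq (by omega))
  have h1 : C 4 * ((X 0 * p₀ + X 1 * p₁) * bubbleCubic) ∈ attainable M :=
    h (t + 5) (by omega) (by omega) _ ((ix.mul isHomogeneous_bubbleCubic).C_mul 4)
  have h2 : C 2 * (normSq * (pderiv 0 bubbleCubic * p₀ + pderiv 1 bubbleCubic * p₁)) ∈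
      attainable M := by
    refine h (t + 5) (by omega) (by omega) _ ?_
    have a₀ := (isHomogeneous_bubbleCubic.pderiv (i := 0)).mul i₀
    have a₁ := (isHomogeneous_bubbleCubic.pderiv (i := 1)).mul i₁
    convert (isHomogeneous_normSq.mul (a₀.add a₁)).C_mul 2 using 1
    omega
  have h3 : pderiv 2 bubbleQuartic * q ∈ attainable M :=
    h (t + 5) (by omega) (by omega) _ (isHomogeneous_pderiv_bubbleQuartic_mul 2 iq)
  have h4 : C 4 * ((X 0 * p₀ + X 1 * p₁) * bubbleQuartic) ∈ attainable M :=
    h (t + 6) (by omega) (by omega) _ ((ix.mul isHomogeneous_bubbleQuartic).C_mul 4)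
  have h5 : C 2 * (normSq * (pderiv 0 bubbleQuartic * p₀ + pderiv 1 bubbleQuartic * p₁)) ∈
      attainable M := by
    refine h (t + 6) (by omega) (by omega) _ ?_
    convert (isHomogeneous_normSq.mul ((isHomogeneous_pderiv_bubbleQuartic_mul 0 i₀).add
      (isHomogeneous_pderiv_bubbleQuartic_mul 1 i₁))).C_mul 2 using 1
    omega
  have hhigh := add_mem (add_mem (add_mem (add_mem h1 h2) h3) h4) h5
  have r1 := rotation_monom₀₁ (by omega) h (a := 2) (b := t) (e := 0) (by omega)
  have r2 := rotation_monom₀₁ (by omega) h (a := 0) (b := t + 2) (e := 0) (by omega)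
  have r3 := rotation_monom₀₁ (by omega) h (a := 0) (b := t) (e := 2) (by omega)
  have hrot := add_mem (add_mem ((attainable M).smul_mem (12 * ((t : ℝ) + 3)) r1)
    ((attainable M).smul_mem (36 + 4 * (t : ℝ)) r2))
    ((attainable M).smul_mem (20 * ((t : ℝ) + 3)) r3)
  have hsum := add_mem ((attainable M).smul_mem ((t : ℝ) + 3) (sub_mem hdiv hhigh)) hrot
  refine mem_attainable_of_C_mul (r := 8 * (t : ℝ)) (by positivity) ?_
  convert hsum using 1
  simp only [hp₀, hp₁, hq, pderiv_mul, pderiv_bubblePoly, pderiv_bubbleCubic, pderiv_bubbleQuartic,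
    pderiv_X_self, smul_eq_C_mul, pderiv_normSq, pderiv_C, pderiv_pow]
  simp [bubblePoly, normSq, bubbleCubic, bubbleQuartic, map_ofNat]
  ring

lemma isHomogeneous_mem_attainable_of_above (hM : m + 2 ≤ M) (hm : 1 ≤ m)
    (h : AttainableAbove M m) {p : MvPolynomial (Fin 3) ℝ} (hp : p.IsHomogeneous m) :
    p ∈ attainable M := by
  refine isHomogeneous_mem_attainable hM h ?_ hp
  rcases Nat.even_or_odd m with he | ho
  · obtain ⟨r, hr⟩ := he
    obtain rfl | rfl | hr3 : r = 1 ∨ r = 2 ∨ 3 ≤ r := by omega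
    · subst hr; exact X1_pow_two_mem_attainable hM h
    · subst hr; exact X1_pow_four_mem_attainable hM h
    · obtain ⟨t, rfl⟩ : ∃ t, m = t + 4 := ⟨m - 4, by omega⟩
      exact X1_pow_mem_attainable_add_four (by omega) (by omega) h
  · exact X1_pow_mem_attainable_of_odd hM h ho

/-- Every polynomial of degree at most `M` is, up to homogeneous polynomials of degrees `M` and
`M - 1` and a constant, the divergence of a field `bubblePoly * W` of degree at most `M + 1`. -/
theorem mem_attainable_of_totalDegree_le {p : MvPolynomial (Fin 3) ℝ} (hp : p.totalDegree ≤ M) :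
    p ∈ attainable M := by
  have above : ∀ d m : ℕ, m + d = M → AttainableAbove M m := by
    intro d
    induction d with
    | zero => intro m hm j h1 h2; omega
    | succ d ih =>
      intro m hm j h1 h2 q hq
      have ih' := ih (m + 1) (by omega)
      rcases (show j = m + 1 ∨ m + 1 < j by omega) with rfl | hj
      · rcases (show m + 1 + 2 ≤ M ∨ m + 1 = M ∨ m + 1 = M - 1 by omega) with h3 | h3 | h3
        · exact isHomogeneous_mem_attainable_of_above h3 (by omega) ih' hq
        · exact Submodule.mem_sup_left (Submodule.mem_sup_right
            (Submodule.mem_sup_left (h3 ▸ hq)))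
        · exact Submodule.mem_sup_left (Submodule.mem_sup_right
            (Submodule.mem_sup_right (h3 ▸ hq)))
      · exact ih' j hj h2 q hq
  rw [← sum_homogeneousComponent p]
  refine sum_mem fun j hj => ?_
  have hj' : j ≤ M := by have := Finset.mem_range.1 hj; omega
  rcases Nat.eq_zero_or_pos j with rfl | hpos
  · rw [homogeneousComponent_zero]; exact C_mem_attainable _
  · exact above M 0 (by omega) j hpos hj' _ (homogeneousComponent_isHomogeneous j p)

end Algebra

/-! ### Weak derivatives -/

section WeakDerivatives

variable {D : Set E3} {v v' : E3 → E3} {G G' : E3 → Fin 3 → Fin 3 → ℝ} {φ : E3 → ℝ}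

lemma IsTestFunction.memLp (hφ : IsTestFunction D φ) {p : ENNReal} {μ : Measure E3}
    [IsFiniteMeasureOnCompacts μ] : MemLp φ p μ :=
  hφ.1.continuous.memLp_of_hasCompactSupport hφ.2.1

lemma continuous_partialDeriv (hφ : ContDiff ℝ ∞ φ) (j : Fin 3) :
    Continuous (partialDeriv j φ) :=
  (hφ.continuous_fderiv (by simp)).clm_apply continuous_const

lemma IsTestFunction.memLp_partialDeriv (hφ : IsTestFunction D φ) (j : Fin 3) {p : ENNReal}
    {μ : Measure E3} [IsFiniteMeasureOnCompacts μ] : MemLp (partialDeriv j φ) p μ :=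
  (continuous_partialDeriv hφ.1 j).memLp_of_hasCompactSupport (hφ.2.1.fderiv_apply ℝ _)

lemma memLp_coord {μ : Measure E3} (hv : MemLp v 2 μ) (i : Fin 3) :
    MemLp (fun x => v x i) 2 μ :=
  (EuclideanSpace.proj (𝕜 := ℝ) i).comp_memLp' hv

/-- Weak Jacobians are unique up to null sets. -/
lemma IsWeakJacobian.ae_eq (hD : IsOpen D) (h : IsWeakJacobian D v G)
    (h' : IsWeakJacobian D v G') : ∀ᵐ x ∂(volume.restrict D), G x = G' x := by
  have key : ∀ i j, ∀ᵐ x ∂(volume.restrict D), G x i j = G' x i j := by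
    intro i j
    have hL : MemLp (fun x => G x i j - G' x i j) 2 (volume.restrict D) := (h.1 i j).sub (h'.1 i j)
    have hloc : LocallyIntegrableOn (fun x => G x i j - G' x i j) D volume :=
      locallyIntegrableOn_of_locallyIntegrable_restrict (hL.locallyIntegrable (by norm_num))
    have := hD.ae_eq_zero_of_integral_contDiff_smul_eq_zero hloc (fun g hg hc hs => ?_)
    · rw [ae_restrict_iff' hD.measurableSet]
      filter_upwards [this] with x hx hxD
      exact sub_eq_zero.1 (hx hxD)
    · have hT : IsTestFunction D g := ⟨hg, hc, hs⟩
      have e := (h.2 i j g hT).symm.trans (h'.2 i j g hT)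
      rw [neg_inj] at e
      have hint : ∀ {H : E3 → ℝ}, MemLp H 2 (volume.restrict D) →
          Integrable (fun x => H x * g x) (volume.restrict D) := fun hH =>
        hH.integrable_mul (hT.memLp (p := 2))
      have e2 : ∫ x in D, g x • (G x i j - G' x i j) = 0 := by
        rw [← sub_eq_zero, ← integral_sub (hint (h.1 i j)) (hint (h'.1 i j))] at e
        rw [← e]
        exact integral_congr_ae (Eventually.of_forall fun x => by simp only [smul_eq_mul]; ring)
      rw [← e2]
      refine (setIntegral_eq_integral_of_forall_compl_eq_zero fun x hx => ?_).symm
      rw [image_eq_zero_of_notMem_tsupport (fun hx' => hx (hs hx')), zero_smul]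
  have : ∀ᵐ x ∂(volume.restrict D), ∀ i j, G x i j = G' x i j :=
    ae_all_iff.2 fun i => ae_all_iff.2 fun j => key i j
  filter_upwards [this] with x hx
  funext i j
  exact hx i j

lemma IsWeakJacobian.congr (hD : IsOpen D) (hv : ∀ x ∈ D, v x = v' x)
    (h : IsWeakJacobian D v G) : IsWeakJacobian D v' G := by
  refine ⟨h.1, fun i j φ hφ => ?_⟩
  rw [← h.2 i j φ hφ]
  exact setIntegral_congr_fun hD.measurableSet fun x hx => by rw [hv x hx]

lemma weakJacobian_spec (h : ∃ G, IsWeakJacobian D v G) :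
    IsWeakJacobian D v (weakJacobian D v) := by
  rw [weakJacobian, dif_pos h]
  exact h.choose_spec

lemma IsWeakJacobian.weakJacobian_ae_eq (hD : IsOpen D) (h : IsWeakJacobian D v G) :
    ∀ᵐ x ∂(volume.restrict D), weakJacobian D v x = G x :=
  (weakJacobian_spec ⟨G, h⟩).ae_eq hD h

lemma IsWeakJacobian.weakDiv_ae_eq (hD : IsOpen D) (h : IsWeakJacobian D v G) :
    ∀ᵐ x ∂(volume.restrict D), weakDiv D v x = ∑ i, G x i i := by
  filter_upwards [h.weakJacobian_ae_eq hD] with x hx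
  rw [weakDiv, hx]

lemma h1Norm_nonneg : 0 ≤ h1Norm D v := Real.sqrt_nonneg _

lemma l2Norm_nonneg {q : E3 → ℝ} : 0 ≤ l2Norm D q := Real.sqrt_nonneg _

lemma IsWeakJacobian.h1Norm_sq (hD : IsOpen D) (h : IsWeakJacobian D v G) :
    h1Norm D v ^ 2 = (∫ x in D, ∑ i, (v x i) ^ 2) + ∫ x in D, ∑ i, ∑ j, (G x i j) ^ 2 := by
  rw [h1Norm, Real.sq_sqrt]
  · congr 1
    refine integral_congr_ae ?_
    filter_upwards [h.weakJacobian_ae_eq hD] with x hx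
    rw [hx]
  · exact add_nonneg (integral_nonneg fun x => by positivity)
      (integral_nonneg fun x => by positivity)

lemma MemH1.congr (hD : IsOpen D) (hv : ∀ x ∈ D, v x = v' x) (h : MemH1 D v) : MemH1 D v' := by
  refine ⟨(memLp_congr_ae ?_).1 h.1, h.2.imp fun G hG => hG.congr hD hv⟩
  exact (ae_restrict_iff' hD.measurableSet).2 (Eventually.of_forall hv)

lemma weakJacobian_congr (hD : IsOpen D) (hv : ∀ x ∈ D, v x = v' x) :
    weakJacobian D v = weakJacobian D v' := by
  have : IsWeakJacobian D v = IsWeakJacobian D v' := by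
    ext G
    exact ⟨fun h => h.congr hD hv, fun h => h.congr hD fun x hx => (hv x hx).symm⟩
  classical
  have gen : ∀ P Q : (E3 → Fin 3 → Fin 3 → ℝ) → Prop, P = Q →
      (if h : ∃ G, P G then h.choose else 0) = if h : ∃ G, Q G then h.choose else 0 := by
    rintro P _ rfl
    rfl
  convert gen _ _ this using 1 <;> (unfold weakJacobian; congr)

lemma h1Norm_congr (hD : IsOpen D) (hv : ∀ x ∈ D, v x = v' x) : h1Norm D v = h1Norm D v' := by
  rw [h1Norm, h1Norm, weakJacobian_congr hD hv]
  congr 2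
  exact setIntegral_congr_fun hD.measurableSet fun x hx => by simp only [hv x hx]

lemma weakDiv_congr (hD : IsOpen D) (hv : ∀ x ∈ D, v x = v' x) : weakDiv D v = weakDiv D v' := by
  funext x
  rw [weakDiv, weakDiv, weakJacobian_congr hD hv]

lemma MemH10.congr (hD : IsOpen D) (hv : ∀ x ∈ D, v x = v' x) (h : MemH10 D v) :
    MemH10 D v' := by
  obtain ⟨h1, φ, hφ, hlim⟩ := h
  refine ⟨h1.congr hD hv, φ, hφ, hlim.congr fun n => h1Norm_congr hD fun x hx => ?_⟩
  simp only [Pi.sub_apply, hv x hx]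

/-! ### Linear combinations -/

lemma integrable_sum_sq {ι' : Type*} (s : Finset ι') {f : ι' → E3 → ℝ} {μ : Measure E3}
    (h : ∀ i ∈ s, MemLp (f i) 2 μ) : Integrable (fun x => ∑ i ∈ s, f i x ^ 2) μ :=
  integrable_finsetSum _ fun i hi => (h i hi).integrable_sq

variable {ι : Type*} [Fintype ι] {u : ι → E3 → E3} {H : ι → E3 → Fin 3 → Fin 3 → ℝ} (c : ι → ℝ)

lemma IsWeakJacobian.sum (hu : ∀ l, MemLp (u l) 2 (volume.restrict D))
    (h : ∀ l, IsWeakJacobian D (u l) (H l)) :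
    IsWeakJacobian D (fun x => ∑ l, c l • u l x) (fun x i j => ∑ l, c l * H l x i j) := by
  refine ⟨fun i j => memLp_finsetSum _ fun l _ => ((h l).1 i j).const_mul (c l),
    fun i j φ hφ => ?_⟩
  have e1 : ∀ x, (∑ l, c l • u l x) i * partialDeriv j φ x
      = ∑ l, c l * (u l x i * partialDeriv j φ x) := by
    intro x
    simp [Finset.sum_mul, mul_assoc]
  have e2 : ∀ x, (∑ l, c l * H l x i j) * φ x = ∑ l, c l * (H l x i j * φ x) := by
    intro x
    simp [Finset.sum_mul, mul_assoc]
  simp only [e1, e2]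
  rw [integral_finsetSum, integral_finsetSum, ← Finset.sum_neg_distrib]
  · refine Finset.sum_congr rfl fun l _ => ?_
    rw [integral_const_mul, integral_const_mul, (h l).2 i j φ hφ, mul_neg]
  · exact fun l _ => (((h l).1 i j).integrable_mul (hφ.memLp (p := 2))).const_mul _
  · exact fun l _ => ((memLp_coord (hu l) i).integrable_mul
      (hφ.memLp_partialDeriv j (p := 2))).const_mul _

lemma MemH1.sum (h : ∀ l, MemH1 D (u l)) : MemH1 D (fun x => ∑ l, c l • u l x) :=
  ⟨memLp_finsetSum _ fun l _ => (h l).1.const_smul (c l),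
    _, IsWeakJacobian.sum c (fun l => (h l).1) fun l => weakJacobian_spec (h l).2⟩

lemma weakDiv_sum (hD : IsOpen D) (h : ∀ l, MemH1 D (u l)) :
    ∀ᵐ x ∂(volume.restrict D),
      weakDiv D (fun x => ∑ l, c l • u l x) x = ∑ l, c l * weakDiv D (u l) x := by
  filter_upwards [(IsWeakJacobian.sum c (fun l => (h l).1)
    fun l => weakJacobian_spec (h l).2).weakDiv_ae_eq hD] with x hx
  rw [hx, Finset.sum_comm]
  exact Finset.sum_congr rfl fun l _ => by rw [weakDiv, Finset.mul_sum]

lemma IsWeakJacobian.integrable_sum_sq (h : IsWeakJacobian D v G) :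
    Integrable (fun x => ∑ i, ∑ j, (G x i j) ^ 2) (volume.restrict D) :=
  integrable_finsetSum _ fun i _ => StokesFE.integrable_sum_sq _ fun j _ => h.1 i j

/-- A substitute for the triangle inequality, by the Cauchy–Schwarz inequality. -/
lemma h1Norm_sum_sq_le (hD : IsOpen D) (h : ∀ l, MemH1 D (u l)) :
    h1Norm D (fun x => ∑ l, c l • u l x) ^ 2 ≤
      Fintype.card ι * ∑ l, c l ^ 2 * h1Norm D (u l) ^ 2 := by
  have hJ := fun l => weakJacobian_spec (h l).2
  have hsum := IsWeakJacobian.sum c (fun l => (h l).1) hJ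
  have cs : ∀ f : ι → ℝ, (∑ l, c l * f l) ^ 2 ≤ Fintype.card ι * ∑ l, c l ^ 2 * f l ^ 2 := by
    intro f
    have := sq_sum_le_card_mul_sum_sq (s := Finset.univ) (f := fun l => c l * f l)
    simpa [mul_pow] using this
  have i1 : ∀ l, Integrable (fun x => ∑ i, (u l x i) ^ 2) (volume.restrict D) := fun l =>
    integrable_sum_sq _ fun i _ => memLp_coord (h l).1 i
  have i2 := fun l => (hJ l).integrable_sum_sq
  rw [hsum.h1Norm_sq hD]
  simp only [fun l => (hJ l).h1Norm_sq hD, mul_add, Finset.sum_add_distrib]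
  refine add_le_add ?_ ?_
  · calc ∫ x in D, ∑ i, ((∑ l, c l • u l x) i) ^ 2
        ≤ ∫ x in D, Fintype.card ι * ∑ l, c l ^ 2 * ∑ i, (u l x i) ^ 2 := by
          refine integral_mono
            (integrable_sum_sq _ fun i _ => memLp_coord (MemH1.sum c h).1 i)
            ((integrable_finsetSum _ fun l _ => (i1 l).const_mul _).const_mul _) fun x => ?_
          simp only [Finset.mul_sum]
          rw [Finset.sum_comm]
          refine Finset.sum_le_sum fun i _ => ?_
          have := cs fun l => u l x i
          simpa [Finset.mul_sum] using this
      _ = _ := by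
          rw [integral_const_mul, integral_finsetSum _ fun l _ => (i1 l).const_mul _]
          simp only [integral_const_mul]
  · calc ∫ x in D, ∑ i, ∑ j, (∑ l, c l * weakJacobian D (u l) x i j) ^ 2
        ≤ ∫ x in D, Fintype.card ι * ∑ l, c l ^ 2 * ∑ i, ∑ j, (weakJacobian D (u l) x i j) ^ 2 := by
          refine integral_mono hsum.integrable_sum_sq
            ((integrable_finsetSum _ fun l _ => (i2 l).const_mul _).const_mul _) fun x => ?_
          have e : (Fintype.card ι : ℝ) *
                ∑ l, c l ^ 2 * ∑ i, ∑ j, (weakJacobian D (u l) x i j) ^ 2 =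
              ∑ i, ∑ j, Fintype.card ι * ∑ l, c l ^ 2 * (weakJacobian D (u l) x i j) ^ 2 := by
            simp only [Finset.mul_sum]
            rw [Finset.sum_comm]
            exact Finset.sum_congr rfl fun i _ => Finset.sum_comm
          simp only [e]
          exact Finset.sum_le_sum fun i _ => Finset.sum_le_sum fun j _ =>
            cs fun l => weakJacobian D (u l) x i j
      _ = _ := by
          rw [integral_const_mul, integral_finsetSum _ fun l _ => (i2 l).const_mul _]
          simp only [integral_const_mul]

lemma MemH1.sub {w : E3 → E3} (hv : MemH1 D v) (hw : MemH1 D w) : MemH1 D (v - w) := by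
  have := MemH1.sum ![1, -1] (u := ![v, w]) (D := D) (by intro l; fin_cases l <;> simpa)
  convert this using 1
  funext x
  simp [sub_eq_add_neg]

lemma weakDiv_sub {w : E3 → E3} (hD : IsOpen D) (hv : MemH1 D v) (hw : MemH1 D w) :
    ∀ᵐ x ∂(volume.restrict D), weakDiv D (v - w) x = weakDiv D v x - weakDiv D w x := by
  have := weakDiv_sum ![1, -1] (u := ![v, w]) hD (by intro l; fin_cases l <;> simpa)
  have e : (fun x => ∑ l, (![1, -1] : Fin 2 → ℝ) l • (![v, w] : Fin 2 → E3 → E3) l x) = v - w := by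
    funext x
    simp [sub_eq_add_neg]
  rw [e] at this
  filter_upwards [this] with x hx
  rw [hx]
  simp [sub_eq_add_neg]

end WeakDerivatives

/-! ### Smooth fields and the closure of the compactly supported ones -/

section Smooth

variable {D : Set E3} {v : E3 → E3}

/-- The classical Jacobian of a vector field. -/
noncomputable def jacobian (v : E3 → E3) (x : E3) (i j : Fin 3) : ℝ :=
  partialDeriv j (fun y => v y i) x

lemma ContDiff.coord (hv : ContDiff ℝ ∞ v) (i : Fin 3) : ContDiff ℝ ∞ fun x => v x i :=
  (EuclideanSpace.proj (𝕜 := ℝ) i).contDiff.comp hv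

lemma continuous_jacobian (hv : ContDiff ℝ ∞ v) (i j : Fin 3) :
    Continuous fun x => jacobian v x i j :=
  continuous_partialDeriv (ContDiff.coord hv i) j

lemma _root_.Continuous.memLp_restrict_of_isBounded {F : Type*} [NormedAddCommGroup F]
    {f : E3 → F} (hf : Continuous f) (hb : Bornology.IsBounded D) {p : ENNReal} :
    MemLp f p (volume.restrict D) := by
  have hK := hb.isCompact_closure
  obtain ⟨C, hC⟩ := hK.exists_bound_of_continuousOn hf.continuousOn
  have : IsFiniteMeasure (volume.restrict (closure D)) := ⟨by simpa using hK.measure_lt_top⟩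
  have h1 : MemLp f p (volume.restrict (closure D)) :=
    MemLp.of_bound hf.aestronglyMeasurable C
      ((ae_restrict_iff' isClosed_closure.measurableSet).2 (Eventually.of_forall hC))
  exact h1.mono_measure (Measure.restrict_mono subset_closure le_rfl)

lemma isWeakJacobian_jacobian (hb : Bornology.IsBounded D) (hv : ContDiff ℝ ∞ v) :
    IsWeakJacobian D v (jacobian v) := by
  refine ⟨fun i j => (continuous_jacobian hv i j).memLp_restrict_of_isBounded hb,
    fun i j φ hφ => ?_⟩
  have hi := ContDiff.coord hv i
  have h0 : ∀ x, x ∉ D → φ x = 0 := fun x hx =>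
    image_eq_zero_of_notMem_tsupport fun h => hx (hφ.2.2 h)
  have h1 : ∀ x, x ∉ D → partialDeriv j φ x = 0 := fun x hx => by
    rw [partialDeriv, fderiv_of_notMem_tsupport ℝ fun h => hx (hφ.2.2 h)]
    simp
  rw [setIntegral_eq_integral_of_forall_compl_eq_zero fun x hx => by rw [h1 x hx, mul_zero],
    setIntegral_eq_integral_of_forall_compl_eq_zero fun x hx => by rw [h0 x hx, mul_zero]]
  have cφ := hφ.1.continuous
  have c1 := continuous_partialDeriv hφ.1 j
  have s1 : HasCompactSupport (partialDeriv j φ) := hφ.2.1.fderiv_apply ℝ _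
  refine integral_mul_fderiv_eq_neg_fderiv_mul_of_integrable ?_ ?_ ?_
    (fun x _ => hi.differentiable (by simp) x) (fun x _ => hφ.1.differentiable (by simp) x)
  · exact ((continuous_jacobian hv i j).mul cφ).integrable_of_hasCompactSupport hφ.2.1.mul_left
  · exact (hi.continuous.mul c1).integrable_of_hasCompactSupport s1.mul_left
  · exact (hi.continuous.mul cφ).integrable_of_hasCompactSupport hφ.2.1.mul_left

lemma memH1_of_contDiff (hb : Bornology.IsBounded D) (hv : ContDiff ℝ ∞ v) : MemH1 D v :=
  ⟨hv.continuous.memLp_restrict_of_isBounded hb, _, isWeakJacobian_jacobian hb hv⟩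

/-- A finite linear combination of fields in `[H¹₀(D)]³` is in `[H¹₀(D)]³`. -/
lemma MemH10.sum {ι : Type*} [Fintype ι] {u : ι → E3 → E3} (c : ι → ℝ) (hD : IsOpen D)
    (hb : Bornology.IsBounded D) (h : ∀ l, MemH10 D (u l)) :
    MemH10 D (fun x => ∑ l, c l • u l x) := by
  choose h1 φ hφ hlim using h
  have hcomp : ∀ n, IsCompact (⋃ l, tsupport (φ l n)) := fun n =>
    isCompact_iUnion fun l => (hφ l n).2.1
  have hsub : ∀ n, Function.support (fun x => ∑ l, c l • φ l n x) ⊆ ⋃ l, tsupport (φ l n) := by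
    intro n x hx
    by_contra hx'
    refine hx (Finset.sum_eq_zero fun l _ => ?_)
    rw [image_eq_zero_of_notMem_tsupport fun h => hx' (Set.mem_iUnion.2 ⟨l, h⟩), smul_zero]
  refine ⟨MemH1.sum c h1, fun n x => ∑ l, c l • φ l n x, fun n =>
    ⟨ContDiff.sum fun l _ => ((hφ l n).1.const_smul (c l)),
      HasCompactSupport.of_support_subset_isCompact (hcomp n) (hsub n),
      (closure_minimal (hsub n) (hcomp n).isClosed).trans
        (Set.iUnion_subset fun l => (hφ l n).2.2)⟩, ?_⟩
  · have hm : ∀ l n, MemH1 D (u l - φ l n) := fun l n =>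
      (h1 l).sub (memH1_of_contDiff hb (hφ l n).1)
    have hle : ∀ n, h1Norm D ((fun x => ∑ l, c l • u l x) - fun x => ∑ l, c l • φ l n x) ≤
        Real.sqrt (Fintype.card ι * ∑ l, c l ^ 2 * h1Norm D (u l - φ l n) ^ 2) := by
      intro n
      refine Real.le_sqrt_of_sq_le ?_
      convert h1Norm_sum_sq_le c hD fun l => hm l n using 3
      funext x
      simp [smul_sub]
    refine squeeze_zero (fun n => h1Norm_nonneg) hle ?_
    have : Tendsto (fun n => Real.sqrt (Fintype.card ι *
        ∑ l, c l ^ 2 * h1Norm D (u l - φ l n) ^ 2)) atTop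
        (𝓝 (Real.sqrt (Fintype.card ι * ∑ l, c l ^ 2 * (0 : ℝ) ^ 2))) :=
      (Real.continuous_sqrt.tendsto _).comp
        ((tendsto_finsetSum _ fun l _ => ((hlim l).pow 2).const_mul _).const_mul _)
    simpa using this

lemma integral_partialDeriv_eq_zero {φ : E3 → ℝ} (hφ : ContDiff ℝ ∞ φ)
    (hc : HasCompactSupport φ) (j : Fin 3) : ∫ x, partialDeriv j φ x = 0 := by
  have := integral_mul_fderiv_eq_neg_fderiv_mul_of_integrable (μ := (volume : Measure E3))
    (f := fun _ => (1 : ℝ)) (g := φ) (v := EuclideanSpace.single j 1) (by simp)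
    (by
      simp only [one_mul]
      exact (continuous_partialDeriv hφ j).integrable_of_hasCompactSupport (hc.fderiv_apply ℝ _))
    (by simpa using hφ.continuous.integrable_of_hasCompactSupport hc)
    (fun x _ => differentiableAt_const _) (fun x _ => hφ.differentiable (by simp) x)
  simpa [partialDeriv] using this

lemma MemH1.integrable_weakDiv (hb : Bornology.IsBounded D) (h : MemH1 D v) :
    Integrable (weakDiv D v) (volume.restrict D) := by
  have : IsFiniteMeasure (volume.restrict D) := ⟨by simpa using hb.measure_lt_top⟩
  exact integrable_finsetSum _ fun i _ =>
    ((weakJacobian_spec h.2).1 i i).integrable (by norm_num)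

/-- The divergence is bounded in the mean by the `H¹` norm, by the Cauchy–Schwarz inequality. -/
lemma sq_integral_weakDiv_le (hD : IsOpen D) (hb : Bornology.IsBounded D) (h : MemH1 D v) :
    (∫ x in D, weakDiv D v x) ^ 2 ≤ 3 * volume.real D * h1Norm D v ^ 2 := by
  have hfin : IsFiniteMeasure (volume.restrict D) := ⟨by simpa using hb.measure_lt_top⟩
  have hJ := weakJacobian_spec h.2
  have hdiv : MemLp (weakDiv D v) 2 (volume.restrict D) := memLp_finsetSum _ fun i _ => hJ.1 i i
  -- nonnegativity of `∫ (t + weakDiv)²` for every `t` bounds the discriminant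
  have hquad : ∀ t : ℝ, 0 ≤ volume.real D * (t * t) + (2 * ∫ x in D, weakDiv D v x) * t +
      ∫ x in D, weakDiv D v x ^ 2 := by
    intro t
    have : 0 ≤ ∫ x in D, (t + weakDiv D v x) ^ 2 := integral_nonneg fun x => sq_nonneg _
    convert this using 1
    have e : ∀ x, (t + weakDiv D v x) ^ 2 = t * t + 2 * t * weakDiv D v x + weakDiv D v x ^ 2 := by
      intro x; ring
    simp only [e]
    have i1 : Integrable (fun x => t * t + 2 * t * weakDiv D v x) (volume.restrict D) :=
      (integrable_const _).add ((h.integrable_weakDiv hb).const_mul _)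
    rw [integral_add i1 hdiv.integrable_sq, integral_add (integrable_const _)
      ((h.integrable_weakDiv hb).const_mul _), integral_const_mul (2 * t)]
    simp [Measure.real]
    ring
  have hdisc := discrim_le_zero hquad
  rw [discrim] at hdisc
  have h3 : ∫ x in D, weakDiv D v x ^ 2 ≤ 3 * h1Norm D v ^ 2 := by
    rw [hJ.h1Norm_sq hD]
    have hle : ∫ x in D, weakDiv D v x ^ 2 ≤
        ∫ x in D, 3 * ∑ i, ∑ j, (weakJacobian D v x i j) ^ 2 := by
      refine integral_mono hdiv.integrable_sq (hJ.integrable_sum_sq.const_mul _) fun x => ?_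
      simp only [weakDiv, Fin.sum_univ_three]
      nlinarith [sq_nonneg (weakJacobian D v x 0 0 - weakJacobian D v x 1 1),
        sq_nonneg (weakJacobian D v x 0 0 - weakJacobian D v x 2 2),
        sq_nonneg (weakJacobian D v x 1 1 - weakJacobian D v x 2 2),
        sq_nonneg (weakJacobian D v x 0 1), sq_nonneg (weakJacobian D v x 0 2),
        sq_nonneg (weakJacobian D v x 1 0), sq_nonneg (weakJacobian D v x 1 2),
        sq_nonneg (weakJacobian D v x 2 0), sq_nonneg (weakJacobian D v x 2 1)]
    rw [integral_const_mul] at hle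
    have : 0 ≤ ∫ x in D, ∑ i, (v x i) ^ 2 := integral_nonneg fun x => by positivity
    linarith
  have hvol : 0 ≤ volume.real D := measureReal_nonneg
  nlinarith [mul_le_mul_of_nonneg_left h3 hvol]

/-- The divergence theorem for fields with vanishing boundary values. -/
lemma MemH10.integral_weakDiv_eq_zero (hD : IsOpen D) (hb : Bornology.IsBounded D)
    (h : MemH10 D v) : ∫ x in D, weakDiv D v x = 0 := by
  obtain ⟨h1, φ, hφ, hlim⟩ := h
  have hφ1 : ∀ n, MemH1 D (φ n) := fun n => memH1_of_contDiff hb (hφ n).1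
  have hzero : ∀ n, ∫ x in D, weakDiv D (φ n) x = 0 := by
    intro n
    rw [integral_congr_ae ((isWeakJacobian_jacobian hb (hφ n).1).weakDiv_ae_eq hD)]
    have hcs : ∀ i, HasCompactSupport fun x => φ n x i := fun i =>
      (hφ n).2.1.comp_left (g := fun y : E3 => y i) rfl
    have hsupp : ∀ x, x ∉ D → ∑ i, jacobian (φ n) x i i = 0 := by
      intro x hx
      refine Finset.sum_eq_zero fun i _ => ?_
      rw [jacobian, partialDeriv, fderiv_of_notMem_tsupport]
      · simp
      · exact fun h' => hx ((hφ n).2.2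
          (tsupport_comp_subset (g := fun y : E3 => y i) rfl (φ n) h'))
    rw [setIntegral_eq_integral_of_forall_compl_eq_zero hsupp, integral_finsetSum]
    · exact Finset.sum_eq_zero fun i _ =>
        integral_partialDeriv_eq_zero (ContDiff.coord (hφ n).1 i) (hcs i) i
    · exact fun i _ => (continuous_jacobian (hφ n).1 i i).integrable_of_hasCompactSupport
        ((hcs i).fderiv_apply ℝ _)
  have hle : ∀ n, (∫ x in D, weakDiv D v x) ^ 2 ≤
      3 * volume.real D * h1Norm D (v - φ n) ^ 2 := by
    intro n
    refine le_trans (le_of_eq ?_) (sq_integral_weakDiv_le hD hb (h1.sub (hφ1 n)))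
    rw [integral_congr_ae (weakDiv_sub hD h1 (hφ1 n)),
      integral_sub (h1.integrable_weakDiv hb) ((hφ1 n).integrable_weakDiv hb), hzero n, sub_zero]
  have hlim' : Tendsto (fun n => 3 * volume.real D * h1Norm D (v - φ n) ^ 2) atTop (𝓝 0) := by
    simpa using (hlim.pow 2).const_mul (3 * volume.real D)
  exact pow_eq_zero_iff (two_ne_zero) |>.1
    (le_antisymm (ge_of_tendsto' hlim' hle) (sq_nonneg _))

end Smooth

/-! ### Bubble fields have vanishing boundary values -/

section Bubble

variable {D : Set E3} {b : E3 → ℝ} {w : E3 → E3}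

lemma deriv_smoothTransition_eq_zero {t : ℝ} (ht : t < 0 ∨ 1 < t) :
    deriv Real.smoothTransition t = 0 := by
  rcases ht with ht | ht
  · have : Real.smoothTransition =ᶠ[𝓝 t] fun _ => 0 := by
      filter_upwards [Iio_mem_nhds ht] with s hs
      exact Real.smoothTransition.zero_of_nonpos (le_of_lt hs)
    rw [this.deriv_eq, deriv_const]
  · have : Real.smoothTransition =ᶠ[𝓝 t] fun _ => 1 := by
      filter_upwards [Ioi_mem_nhds ht] with s hs
      exact Real.smoothTransition.one_of_one_le (le_of_lt hs)
    rw [this.deriv_eq, deriv_const]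

/-- The factor `n` from differentiating the cutoff `smoothTransition (n b - 1)` is compensated by
the factor `b` of the bubble field, as `n b ≤ 2` where the cutoff is not constant. -/
lemma exists_bound_deriv_smoothTransition :
    ∃ C : ℝ, 0 ≤ C ∧ ∀ s : ℝ, |(s + 1) * deriv Real.smoothTransition s| ≤ C := by
  have hc : Continuous fun s : ℝ => (s + 1) * deriv Real.smoothTransition s :=
    (continuous_id.add continuous_const).mul
      ((Real.smoothTransition.contDiff (n := 1)).continuous_deriv le_rfl)
  obtain ⟨C, hC⟩ := (isCompact_Icc (a := (0 : ℝ)) (b := 1)).exists_bound_of_continuousOn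
    hc.continuousOn
  have h0 : 0 ≤ C := (norm_nonneg _).trans (hC 0 (by simp))
  refine ⟨C, h0, fun s => ?_⟩
  by_cases hs : s ∈ Set.Icc (0 : ℝ) 1
  · exact hC s hs
  · rw [deriv_smoothTransition_eq_zero, mul_zero, abs_zero]
    · exact h0
    · by_contra! h
      exact hs ⟨h.1, h.2⟩

lemma partialDeriv_mul {f g : E3 → ℝ} {x : E3} (hf : DifferentiableAt ℝ f x)
    (hg : DifferentiableAt ℝ g x) (j : Fin 3) :
    partialDeriv j (fun y => f y * g y) x =
      f x * partialDeriv j g x + g x * partialDeriv j f x := by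
  simp [partialDeriv, fderiv_fun_mul hf hg]

/-- A smooth multiple of a function `b` that is positive in `D` and vanishes on the boundary lies
in `[H¹₀(D)]³`: it is the limit of its products with the cutoffs `smoothTransition (n b - 1)`. -/
theorem memH10_smul_of_frontier (hD : IsOpen D) (hb : Bornology.IsBounded D)
    (hbs : ContDiff ℝ ∞ b) (hw : ContDiff ℝ ∞ w) (hpos : ∀ x ∈ D, 0 < b x)
    (hfr : ∀ x ∈ frontier D, b x = 0) : MemH10 D (fun x => b x • w x) := by
  classical
  have hv : ContDiff ℝ ∞ fun x => b x • w x := hbs.smul hw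
  -- the cutoff functions, smooth on the whole space
  let χ : ℕ → E3 → ℝ := fun n x => Real.smoothTransition ((n + 1 : ℝ) * b x - 1)
  have hχ : ∀ n, ContDiff ℝ ∞ (χ n) := fun n =>
    Real.smoothTransition.contDiff.comp ((contDiff_const.mul hbs).sub contDiff_const)
  let φ : ℕ → E3 → E3 := fun n => D.indicator fun x => χ n x • b x • w x
  let S : ℕ → Set E3 := fun n => closure D ∩ {x | 1 ≤ (n + 1 : ℝ) * b x}
  have hScl : ∀ n, IsClosed (S n) := fun n =>
    isClosed_closure.inter (isClosed_le continuous_const (continuous_const.mul hbs.continuous))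
  have hSc : ∀ n, IsCompact (S n) := fun n =>
    hb.isCompact_closure.of_isClosed_subset (hScl n) Set.inter_subset_left
  have hSD : ∀ n, S n ⊆ D := by
    rintro n x ⟨hx1, hx2⟩
    by_contra hx
    have : b x = 0 := hfr x ⟨hx1, by rwa [hD.interior_eq]⟩
    rw [Set.mem_ofPred_eq, this, mul_zero] at hx2
    norm_num at hx2
  have hφS : ∀ n x, x ∉ S n → φ n x = 0 := by
    intro n x hx
    by_cases hxD : x ∈ D
    · have : ¬ (1 ≤ (n + 1 : ℝ) * b x) := fun h => hx ⟨subset_closure hxD, h⟩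
      have h0 : χ n x = 0 := Real.smoothTransition.zero_of_nonpos (by linarith [not_le.1 this])
      simp [φ, h0]
    · simp [φ, hxD]
  have hsub : ∀ n, Function.support (φ n) ⊆ S n := fun n x hx => by
    by_contra h
    exact hx (hφS n x h)
  have hφD : ∀ n x, x ∈ D → φ n x = χ n x • b x • w x := fun n x hx => by simp [φ, hx]
  have hφs : ∀ n, ContDiff ℝ ∞ (φ n) := by
    intro n
    refine contDiff_iff_contDiffAt.2 fun x => ?_
    by_cases hx : x ∈ D
    · refine (((hχ n).smul hv).contDiffAt (x := x)).congr_of_eventuallyEq ?_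
      filter_upwards [hD.mem_nhds hx] with y hy using hφD n y hy
    · refine (contDiffAt_const (c := (0 : E3))).congr_of_eventuallyEq ?_
      filter_upwards [(hScl n).isOpen_compl.mem_nhds fun h => hx (hSD n h)] with y hy
      exact hφS n y hy
  refine ⟨memH1_of_contDiff hb hv, φ, fun n => ⟨hφs n,
    HasCompactSupport.of_support_subset_isCompact (hSc n) (hsub n),
    (closure_minimal (hsub n) (hScl n)).trans (hSD n)⟩, ?_⟩
  have hd : ∀ n, ContDiff ℝ ∞ ((fun x => b x • w x) - φ n) := fun n => hv.sub (hφs n)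
  obtain ⟨C, hC0, hC⟩ := exists_bound_deriv_smoothTransition
  -- values and derivatives of the difference inside `D`
  have hval : ∀ n, ∀ x ∈ D, ∀ i, ((fun x => b x • w x) - φ n) x i
      = (1 - χ n x) * (b x * w x i) := by
    intro n x hx i
    simp only [Pi.sub_apply, hφD n x hx, PiLp.sub_apply, PiLp.smul_apply, smul_eq_mul]
    ring
  have hχd : ∀ n x j, partialDeriv j (fun y => 1 - χ n y) x =
      -((n + 1 : ℝ) * deriv Real.smoothTransition ((n + 1 : ℝ) * b x - 1) *
        partialDeriv j b x) := by
    intro n x j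
    have h1 : HasFDerivAt (fun y => (n + 1 : ℝ) * b y - 1) ((n + 1 : ℝ) • fderiv ℝ b x) x :=
      (((hbs.differentiable (by simp)) x).hasFDerivAt.const_mul _).sub_const 1
    have h2 : HasDerivAt Real.smoothTransition
        (deriv Real.smoothTransition ((n + 1 : ℝ) * b x - 1)) ((n + 1 : ℝ) * b x - 1) :=
      ((Real.smoothTransition.contDiff (n := 1)).differentiable (by simp) _).hasDerivAt
    have h3 := (h2.comp_hasFDerivAt x h1).const_sub 1
    change HasFDerivAt (fun y => 1 - χ n y) _ x at h3
    rw [partialDeriv, h3.fderiv]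
    simp [partialDeriv]
    ring
  have hjac : ∀ n, ∀ x ∈ D, ∀ i j, jacobian ((fun x => b x • w x) - φ n) x i j =
      (1 - χ n x) * jacobian (fun x => b x • w x) x i j -
        (((n + 1 : ℝ) * b x - 1) + 1) * deriv Real.smoothTransition ((n + 1 : ℝ) * b x - 1) *
          (partialDeriv j b x * w x i) := by
    intro n x hx i j
    have hloc : (fun y => ((fun x => b x • w x) - φ n) y i) =ᶠ[𝓝 x]
        fun y => (1 - χ n y) * (b y • w y) i := by
      filter_upwards [hD.mem_nhds hx] with y hy
      simpa using hval n y hy i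
    rw [jacobian, partialDeriv, hloc.fderiv_eq]
    have := partialDeriv_mul (x := x) (f := fun y => 1 - χ n y) (g := fun y => (b y • w y) i)
      ((contDiff_const.sub (hχ n)).differentiable (by simp) x)
      ((ContDiff.coord hv i).differentiable (by simp) x) j
    rw [partialDeriv, hχd] at this
    rw [this, jacobian]
    simp only [PiLp.smul_apply, smul_eq_mul]
    ring
  have hχ01 : ∀ n x, |1 - χ n x| ≤ 1 := fun n x => by
    rw [abs_le]
    constructor
    · linarith [Real.smoothTransition.le_one ((n + 1 : ℝ) * b x - 1)]
    · linarith [Real.smoothTransition.nonneg ((n + 1 : ℝ) * b x - 1)]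
  have hlim0 : ∀ x ∈ D, ∀ᶠ n : ℕ in atTop, 1 < (n + 1 : ℝ) * b x - 1 := by
    intro x hx
    have : Tendsto (fun n : ℕ => (n + 1 : ℝ) * b x) atTop atTop :=
      (tendsto_atTop_add_const_right _ _ tendsto_natCast_atTop_atTop).atTop_mul_const (hpos x hx)
    filter_upwards [this.eventually_gt_atTop 2] with n hn
    linarith
  -- dominated convergence for the square of the norm
  let f : ℕ → E3 → ℝ := fun n x => (∑ i, (((fun x => b x • w x) - φ n) x i) ^ 2) +
    ∑ i, ∑ j, (jacobian ((fun x => b x • w x) - φ n) x i j) ^ 2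
  let g : E3 → ℝ := fun x => (∑ i, ((b x • w x) i) ^ 2) + ∑ i, ∑ j,
    (|jacobian (fun x => b x • w x) x i j| + C * |partialDeriv j b x * w x i|) ^ 2
  have hgc : Continuous g := by
    refine (continuous_finsetSum _ fun i _ => (ContDiff.coord hv i).continuous.pow 2).add
      (continuous_finsetSum _ fun i _ => continuous_finsetSum _ fun j _ => Continuous.pow ?_ 2)
    exact (continuous_jacobian hv i j).abs.add (continuous_const.mul
      ((continuous_partialDeriv hbs j).mul (ContDiff.coord hw i).continuous).abs)
  have hgi : Integrable g (volume.restrict D) :=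
    memLp_one_iff_integrable.1 (hgc.memLp_restrict_of_isBounded hb)
  have hfc : ∀ n, Continuous (f n) := fun n =>
    (continuous_finsetSum _ fun i _ => (ContDiff.coord (hd n) i).continuous.pow 2).add
      (continuous_finsetSum _ fun i _ => continuous_finsetSum _ fun j _ =>
        (continuous_jacobian (hd n) i j).pow 2)
  have hfg : ∀ n, ∀ x ∈ D, ‖f n x‖ ≤ g x := by
    intro n x hx
    have hf0 : 0 ≤ f n x := by positivity
    rw [Real.norm_of_nonneg hf0]
    refine add_le_add (Finset.sum_le_sum fun i _ => ?_)
      (Finset.sum_le_sum fun i _ => Finset.sum_le_sum fun j _ => ?_)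
    · rw [hval n x hx i, mul_pow, ← sq_abs]
      have h1 : |1 - χ n x| ^ 2 ≤ 1 := pow_le_one₀ (abs_nonneg _) (hχ01 n x)
      have h2 : 0 ≤ (b x * w x i) ^ 2 := sq_nonneg _
      simpa using mul_le_mul_of_nonneg_right h1 h2
    · rw [hjac n x hx i j, ← sq_abs]
      refine pow_le_pow_left₀ (abs_nonneg _) ((abs_sub _ _).trans (add_le_add ?_ ?_)) 2
      · rw [abs_mul]
        exact mul_le_of_le_one_left (abs_nonneg _) (hχ01 n x)
      · rw [abs_mul]
        exact mul_le_mul_of_nonneg_right (hC _) (abs_nonneg _)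
  have hflim : ∀ x ∈ D, Tendsto (fun n => f n x) atTop (𝓝 0) := by
    intro x hx
    refine tendsto_const_nhds.congr' ?_
    filter_upwards [hlim0 x hx] with n hn
    have h1 : χ n x = 1 := Real.smoothTransition.one_of_one_le hn.le
    simp only [f, hval n x hx, hjac n x hx, h1, deriv_smoothTransition_eq_zero (Or.inr hn)]
    simp
  have hmain : Tendsto (fun n => ∫ x in D, f n x) atTop (𝓝 (∫ _ in D, (0 : ℝ))) :=
    tendsto_integral_of_dominated_convergence g (fun n => (hfc n).aestronglyMeasurable) hgi
      (fun n => (ae_restrict_iff' hD.measurableSet).2 (Eventually.of_forall (hfg n)))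
      ((ae_restrict_iff' hD.measurableSet).2 (Eventually.of_forall hflim))
  have heq : ∀ n, h1Norm D ((fun x => b x • w x) - φ n) = Real.sqrt (∫ x in D, f n x) := by
    intro n
    rw [← Real.sqrt_sq (h1Norm_nonneg (D := D)), (isWeakJacobian_jacobian hb (hd n)).h1Norm_sq hD,
      ← integral_add]
    · exact integrable_sum_sq _ fun i _ =>
        (ContDiff.coord (hd n) i).continuous.memLp_restrict_of_isBounded hb
    · exact (isWeakJacobian_jacobian hb (hd n)).integrable_sum_sq
  simp only [heq]
  simpa [Function.comp_def] using (Real.continuous_sqrt.tendsto _).comp hmain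

end Bubble

/-! ### Affine changes of variables -/

section Affine

variable (F : E3 ≃ᵃ[ℝ] E3) {D : Set E3} {v : E3 → E3} {G : E3 → Fin 3 → Fin 3 → ℝ}

lemma affineEquiv_apply (x : E3) : F x = F.linear x + F 0 := by
  simpa using F.map_vadd 0 x

lemma contDiff_affineEquiv : ContDiff ℝ ∞ F := by
  have : (F : E3 → E3) = fun x =>
      LinearMap.toContinuousLinearMap (F.linear : E3 →ₗ[ℝ] E3) x + F 0 := by
    funext x
    exact affineEquiv_apply F x
  rw [this]
  exact (ContinuousLinearMap.contDiff _).add contDiff_const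

lemma hasFDerivAt_affineEquiv (x : E3) :
    HasFDerivAt F (LinearMap.toContinuousLinearMap (F.linear : E3 →ₗ[ℝ] E3)) x := by
  have : (F : E3 → E3) = fun x =>
      LinearMap.toContinuousLinearMap (F.linear : E3 →ₗ[ℝ] E3) x + F 0 := by
    funext x
    exact affineEquiv_apply F x
  conv => congr; rw [this]
  exact (ContinuousLinearMap.hasFDerivAt _).add_const _

/-- The absolute value of the determinant of the linear part of an affine equivalence. -/
noncomputable def absDet : ℝ := |LinearMap.det (F.linear : E3 →ₗ[ℝ] E3)|

lemma absDet_pos : 0 < absDet F := abs_pos.2 F.linear.isUnit_det'.ne_zero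

/-- An affine equivalence as a homeomorphism. -/
def affineHomeo : E3 ≃ₜ E3 :=
  { F.toEquiv with
    continuous_toFun := (contDiff_affineEquiv F).continuous
    continuous_invFun := (contDiff_affineEquiv F.symm).continuous }

lemma measurableEmbedding_affineEquiv : MeasurableEmbedding F :=
  (affineHomeo F).measurableEmbedding

lemma map_restrict_affineEquiv (D : Set E3) :
    Measure.map F (volume.restrict (F ⁻¹' D)) =
      ENNReal.ofReal (absDet F)⁻¹ • volume.restrict D := by
  have h1 : Measure.map F (volume : Measure E3) =
      ENNReal.ofReal (absDet F)⁻¹ • (volume : Measure E3) := by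
    have e : (F : E3 → E3) = (fun x => x + F 0) ∘ (F.linear : E3 →ₗ[ℝ] E3) := by
      funext x
      exact affineEquiv_apply F x
    rw [e, ← Measure.map_map (measurable_add_const _)
      (LinearMap.continuous_of_finiteDimensional _).measurable,
      Measure.map_linearMap_addHaar_eq_smul_addHaar _ F.linear.isUnit_det'.ne_zero,
      Measure.map_smul, map_add_right_eq_self, absDet, abs_inv]
  rw [← (measurableEmbedding_affineEquiv F).restrict_map, h1, Measure.restrict_smul]

lemma setIntegral_affineEquiv (f : E3 → ℝ) :
    ∫ x in D, f x = absDet F * ∫ x in F ⁻¹' D, f (F x) := by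
  have h := (measurableEmbedding_affineEquiv F).integral_map (μ := volume.restrict (F ⁻¹' D)) f
  rw [map_restrict_affineEquiv, integral_smul_measure,
    ENNReal.toReal_ofReal (inv_nonneg.2 (absDet_pos F).le)] at h
  rw [← h, smul_eq_mul, mul_inv_cancel_left₀ (absDet_pos F).ne']

lemma memLp_comp_affineEquiv {E : Type*} [NormedAddCommGroup E] {f : E3 → E} {p : ENNReal} :
    MemLp (fun x => f (F x)) p (volume.restrict (F ⁻¹' D)) ↔ MemLp f p (volume.restrict D) := by
  have h := (measurableEmbedding_affineEquiv F).memLp_map_measure_iff (g := f) (p := p)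
    (μ := volume.restrict (F ⁻¹' D))
  rw [map_restrict_affineEquiv] at h
  rw [show (fun x => f (F x)) = f ∘ F from rfl, ← h]
  refine ⟨fun h' => ?_, fun h' => h'.smul_measure ENNReal.ofReal_ne_top⟩
  have h2 := h'.smul_measure (c := ENNReal.ofReal (absDet F)) ENNReal.ofReal_ne_top
  rwa [smul_smul, ← ENNReal.ofReal_mul (absDet_pos F).le, mul_inv_cancel₀ (absDet_pos F).ne',
    ENNReal.ofReal_one, one_smul] at h2

lemma ae_comp_affineEquiv {p : E3 → Prop} (h : ∀ᵐ x ∂(volume.restrict (F ⁻¹' D)), p x) :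
    ∀ᵐ x ∂(volume.restrict D), p (F.symm x) := by
  have h1 : ∀ᵐ x ∂(Measure.map F (volume.restrict (F ⁻¹' D))), p (F.symm x) :=
    (measurableEmbedding_affineEquiv F).ae_map_iff.2 (by simpa using h)
  rw [map_restrict_affineEquiv] at h1
  have h0 : ENNReal.ofReal (absDet F)⁻¹ ≠ 0 := by simpa using absDet_pos F
  rwa [ae_iff, Measure.smul_apply, smul_eq_mul, mul_eq_zero, or_iff_right h0, ← ae_iff] at h1

lemma l2Norm_affineEquiv (q : E3 → ℝ) :
    l2Norm D q ^ 2 = absDet F * l2Norm (F ⁻¹' D) (fun x => q (F x)) ^ 2 := by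
  rw [l2Norm, l2Norm, Real.sq_sqrt (integral_nonneg fun x => sq_nonneg _),
    Real.sq_sqrt (integral_nonneg fun x => sq_nonneg _), setIntegral_affineEquiv F]

/-- The contravariant Piola transform of a field, without the determinant. -/
noncomputable def piola (v : E3 → E3) (x : E3) : E3 := F.linear (v (F.symm x))

/-- The matrix of the linear part of `F`. -/
noncomputable def entry (i l : Fin 3) : ℝ := F.linear (EuclideanSpace.single l 1) i

/-- The Jacobian of the Piola transform of a field. -/
noncomputable def piolaJacobian (G : E3 → Fin 3 → Fin 3 → ℝ) (x : E3) (i j : Fin 3) : ℝ :=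
  ∑ l, ∑ k, entry F i l * entry F.symm k j * G (F.symm x) l k

lemma linear_apply_eq_sum (y : E3) (i : Fin 3) : F.linear y i = ∑ l, entry F i l * y l := by
  have h : y = ∑ l, y l • EuclideanSpace.single l (1 : ℝ) := by
    ext j
    simp [Pi.single_apply]
  conv_lhs => rw [h]
  simp [entry, map_sum, mul_comm]

lemma sum_entry_symm_mul_entry (k l : Fin 3) :
    ∑ i, entry F.symm k i * entry F i l = if k = l then 1 else 0 := by
  have h := linear_apply_eq_sum F.symm (F.linear (EuclideanSpace.single l 1)) k
  have e : F.symm.linear (F.linear (EuclideanSpace.single l (1 : ℝ))) =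
      EuclideanSpace.single l 1 := by
    simp
  rw [e] at h
  simp only [entry] at h ⊢
  rw [← h]
  simp

lemma IsTestFunction.comp_affineEquiv {φ : E3 → ℝ} (h : IsTestFunction D φ) :
    IsTestFunction (F ⁻¹' D) (fun x => φ (F x)) := by
  refine ⟨h.1.comp (contDiff_affineEquiv F),
    h.2.1.comp_homeomorph (affineHomeo F), ?_⟩
  rw [show (fun x => φ (F x)) = φ ∘ (affineHomeo F) from rfl,
    tsupport_comp_eq_preimage]
  exact Set.preimage_mono h.2.2

lemma partialDeriv_affineEquiv {φ : E3 → ℝ} (h : ContDiff ℝ ∞ φ) (j : Fin 3) (x : E3) :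
    partialDeriv j φ (F x) = ∑ k, entry F.symm k j * partialDeriv k (fun y => φ (F y)) x := by
  have hφ : HasFDerivAt φ (fderiv ℝ φ (F x)) (F x) :=
    (h.differentiable (by simp) _).hasFDerivAt
  have hc := (hφ.comp x (hasFDerivAt_affineEquiv F x)).fderiv
  rw [show φ ∘ F = fun y => φ (F y) from rfl] at hc
  have hsum : F.symm.linear (EuclideanSpace.single j (1 : ℝ)) =
      ∑ k, entry F.symm k j • EuclideanSpace.single k (1 : ℝ) := by
    ext i
    simp [entry, Pi.single_apply]
  have hj : EuclideanSpace.single j (1 : ℝ) =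
      F.linear (∑ k, entry F.symm k j • EuclideanSpace.single k (1 : ℝ)) := by
    rw [← hsum]
    simp
  rw [partialDeriv, hj]
  simp only [partialDeriv, hc]
  simp [map_sum]

lemma IsWeakJacobian.piola (hv : MemLp v 2 (volume.restrict (F ⁻¹' D)))
    (h : IsWeakJacobian (F ⁻¹' D) v G) :
    IsWeakJacobian D (piola F v) (piolaJacobian F G) := by
  constructor
  · intro i j
    rw [← memLp_comp_affineEquiv F]
    simp only [piolaJacobian, AffineEquiv.symm_apply_apply]
    exact memLp_finsetSum _ fun l _ => memLp_finsetSum _ fun k _ => (h.1 l k).const_mul _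
  · intro i j φ hφ
    have hT := hφ.comp_affineEquiv F
    rw [setIntegral_affineEquiv F (D := D),
      setIntegral_affineEquiv F (D := D) (fun x => piolaJacobian F G x i j * φ x),
      ← mul_neg]
    congr 1
    have e1 : ∀ x, StokesFE.piola F v (F x) i * partialDeriv j φ (F x) =
        ∑ l, ∑ k, entry F i l * entry F.symm k j *
          (v x l * partialDeriv k (fun y => φ (F y)) x) := by
      intro x
      rw [StokesFE.piola, AffineEquiv.symm_apply_apply, linear_apply_eq_sum,
        partialDeriv_affineEquiv F hφ.1, Finset.sum_mul_sum]
      exact Finset.sum_congr rfl fun l _ => Finset.sum_congr rfl fun k _ => by ring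
    have e2 : ∀ x, piolaJacobian F G (F x) i j * φ (F x) =
        ∑ l, ∑ k, entry F i l * entry F.symm k j * (G x l k * φ (F x)) := by
      intro x
      simp only [piolaJacobian, AffineEquiv.symm_apply_apply, Finset.sum_mul]
      exact Finset.sum_congr rfl fun l _ => Finset.sum_congr rfl fun k _ => by ring
    have i1 : ∀ l k, Integrable (fun x => entry F i l * entry F.symm k j *
        (v x l * partialDeriv k (fun y => φ (F y)) x)) (volume.restrict (F ⁻¹' D)) := fun l k =>
      ((memLp_coord hv l).integrable_mul (hT.memLp_partialDeriv k (p := 2))).const_mul _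
    have i2 : ∀ l k, Integrable (fun x => entry F i l * entry F.symm k j *
        (G x l k * φ (F x))) (volume.restrict (F ⁻¹' D)) := fun l k =>
      ((h.1 l k).integrable_mul (hT.memLp (p := 2))).const_mul _
    simp only [e1, e2]
    rw [integral_finsetSum _ fun l _ => integrable_finsetSum _ fun k _ => i1 l k,
      integral_finsetSum _ fun l _ => integrable_finsetSum _ fun k _ => i2 l k,
      ← Finset.sum_neg_distrib]
    refine Finset.sum_congr rfl fun l _ => ?_
    rw [integral_finsetSum _ fun k _ => i1 l k, integral_finsetSum _ fun k _ => i2 l k,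
      ← Finset.sum_neg_distrib]
    refine Finset.sum_congr rfl fun k _ => ?_
    rw [integral_const_mul, integral_const_mul, h.2 l k _ hT, mul_neg]

lemma MemH1.piola (h : MemH1 (F ⁻¹' D) v) : MemH1 D (piola F v) := by
  refine ⟨?_, _, (weakJacobian_spec h.2).piola F h.1⟩
  rw [← memLp_comp_affineEquiv F]
  simp only [StokesFE.piola, AffineEquiv.symm_apply_apply]
  exact (LinearMap.toContinuousLinearMap (F.linear : E3 →ₗ[ℝ] E3)).comp_memLp' h.1

/-- The Piola transform preserves divergences. -/
lemma weakDiv_piola (hD : IsOpen D) (h : MemH1 (F ⁻¹' D) v) :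
    ∀ᵐ x ∂(volume.restrict D), weakDiv D (piola F v) x = weakDiv (F ⁻¹' D) v (F.symm x) := by
  filter_upwards [((weakJacobian_spec h.2).piola F h.1).weakDiv_ae_eq hD] with x hx
  rw [hx, weakDiv]
  simp only [piolaJacobian]
  rw [Finset.sum_comm]
  refine Finset.sum_congr rfl fun l _ => ?_
  rw [Finset.sum_comm]
  have e : ∀ k, ∑ i, entry F i l * entry F.symm k i *
      weakJacobian (F ⁻¹' D) v (F.symm x) l k =
      if k = l then weakJacobian (F ⁻¹' D) v (F.symm x) l k else 0 := by
    intro k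
    rw [← Finset.sum_mul]
    simp only [mul_comm (entry F _ l), sum_entry_symm_mul_entry]
    simp
  simp only [e]
  simp

lemma h1Norm_piola_sq_le (hD : IsOpen D) (h : MemH1 (F ⁻¹' D) v) {α β : ℝ}
    (hα : ∀ i l, |entry F i l| ≤ α) (hβ : ∀ i l, |entry F.symm i l| ≤ β) :
    h1Norm D (piola F v) ^ 2 ≤
      absDet F * ((9 * α ^ 2 + 81 * (α ^ 2 * β ^ 2)) * h1Norm (F ⁻¹' D) v ^ 2) := by
  have hD' : IsOpen (F ⁻¹' D) := hD.preimage (contDiff_affineEquiv F).continuous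
  have hJ := weakJacobian_spec h.2
  have hp := MemH1.piola F h
  rw [(hJ.piola F h.1).h1Norm_sq hD, hJ.h1Norm_sq hD',
    setIntegral_affineEquiv F (D := D) (fun x => ∑ i, (piola F v x i) ^ 2),
    setIntegral_affineEquiv F (D := D), ← mul_add]
  refine mul_le_mul_of_nonneg_left ?_ (absDet_pos F).le
  have hα2 : ∀ i l, entry F i l ^ 2 ≤ α ^ 2 := fun i l => by
    rw [← sq_abs]; exact pow_le_pow_left₀ (abs_nonneg _) (hα i l) 2
  have hβ2 : ∀ i l, entry F.symm i l ^ 2 ≤ β ^ 2 := fun i l => by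
    rw [← sq_abs]; exact pow_le_pow_left₀ (abs_nonneg _) (hβ i l) 2
  have i1 : Integrable (fun x => ∑ i, (v x i) ^ 2) (volume.restrict (F ⁻¹' D)) :=
    integrable_sum_sq _ fun i _ => memLp_coord h.1 i
  have b1 : ∫ x in F ⁻¹' D, ∑ i, (piola F v (F x) i) ^ 2 ≤
      9 * α ^ 2 * ∫ x in F ⁻¹' D, ∑ i, (v x i) ^ 2 := by
    rw [← integral_const_mul]
    refine integral_mono (integrable_sum_sq _ fun i _ => memLp_coord
      ((memLp_comp_affineEquiv F).2 hp.1) i) (i1.const_mul _) fun x => ?_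
    have hi : ∀ i, (piola F v (F x) i) ^ 2 ≤ 3 * (α ^ 2 * ∑ l, (v x l) ^ 2) := by
      intro i
      rw [piola, AffineEquiv.symm_apply_apply, linear_apply_eq_sum]
      refine (sq_sum_le_card_mul_sum_sq (s := Finset.univ)).trans ?_
      rw [Finset.card_univ, Fintype.card_fin, Nat.cast_ofNat]
      refine mul_le_mul_of_nonneg_left ?_ (by norm_num)
      rw [Finset.mul_sum]
      refine Finset.sum_le_sum fun l _ => ?_
      rw [mul_pow]
      exact mul_le_mul_of_nonneg_right (hα2 i l) (sq_nonneg _)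
    refine (Finset.sum_le_sum fun i _ => hi i).trans (le_of_eq ?_)
    rw [Finset.sum_const, Finset.card_univ, Fintype.card_fin, nsmul_eq_mul]
    push_cast
    ring
  have b2 : ∫ x in F ⁻¹' D, ∑ i, ∑ j,
        (piolaJacobian F (weakJacobian (F ⁻¹' D) v) (F x) i j) ^ 2 ≤
      81 * (α ^ 2 * β ^ 2) * ∫ x in F ⁻¹' D, ∑ i, ∑ j, (weakJacobian (F ⁻¹' D) v x i j) ^ 2 := by
    rw [← integral_const_mul]
    refine integral_mono (integrable_finsetSum _ fun i _ => integrable_sum_sq _ fun j _ =>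
      (memLp_comp_affineEquiv F).2 ((hJ.piola F h.1).1 i j)) (hJ.integrable_sum_sq.const_mul _)
      fun x => ?_
    have hij : ∀ i j, (piolaJacobian F (weakJacobian (F ⁻¹' D) v) (F x) i j) ^ 2 ≤
        3 * ∑ l, (3 * ∑ k, α ^ 2 * β ^ 2 * (weakJacobian (F ⁻¹' D) v x l k) ^ 2) := by
      intro i j
      rw [piolaJacobian, AffineEquiv.symm_apply_apply]
      refine (sq_sum_le_card_mul_sum_sq (s := Finset.univ)).trans ?_
      rw [Finset.card_univ, Fintype.card_fin, Nat.cast_ofNat]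
      gcongr with l
      refine (sq_sum_le_card_mul_sum_sq (s := Finset.univ)).trans ?_
      rw [Finset.card_univ, Fintype.card_fin, Nat.cast_ofNat]
      gcongr with k
      rw [mul_pow, mul_pow]
      exact mul_le_mul_of_nonneg_right (mul_le_mul (hα2 i l) (hβ2 k j) (sq_nonneg _)
        (sq_nonneg _)) (sq_nonneg _)
    refine (Finset.sum_le_sum fun i _ => Finset.sum_le_sum fun j _ => hij i j).trans (le_of_eq ?_)
    simp only [Fin.sum_univ_three]
    ring
  have n1 : 0 ≤ ∫ x in F ⁻¹' D, ∑ i, (v x i) ^ 2 := integral_nonneg fun x => by positivity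
  have n2 : 0 ≤ ∫ x in F ⁻¹' D, ∑ i, ∑ j, (weakJacobian (F ⁻¹' D) v x i j) ^ 2 :=
    integral_nonneg fun x => by positivity
  have p1 : 0 ≤ 9 * α ^ 2 := by positivity
  have p2 : 0 ≤ 81 * (α ^ 2 * β ^ 2) := by positivity
  nlinarith [mul_nonneg p1 n2, mul_nonneg p2 n1]

lemma exists_entry_bound : ∃ α : ℝ, ∀ i l, |entry F i l| ≤ α :=
  ⟨∑ i, ∑ l, |entry F i l|, fun i l =>
    (Finset.single_le_sum (f := fun l => |entry F i l|) (fun _ _ => abs_nonneg _)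
      (Finset.mem_univ l)).trans
    (Finset.single_le_sum (f := fun i => ∑ l, |entry F i l|)
      (fun _ _ => Finset.sum_nonneg fun _ _ => abs_nonneg _) (Finset.mem_univ i))⟩

lemma contDiff_piola {φ : E3 → E3} (h : ContDiff ℝ ∞ φ) : ContDiff ℝ ∞ (piola F φ) :=
  (LinearMap.toContinuousLinearMap (F.linear : E3 →ₗ[ℝ] E3)).contDiff.comp
    (h.comp (contDiff_affineEquiv F.symm))

/-- The Piola transform preserves vanishing boundary values. -/
lemma MemH10.piola (hD : IsOpen D) (hb : Bornology.IsBounded (F ⁻¹' D))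
    (h : MemH10 (F ⁻¹' D) v) : MemH10 D (piola F v) := by
  obtain ⟨h1, φ, hφ, hlim⟩ := h
  have hts : ∀ n, tsupport (StokesFE.piola F (φ n)) ⊆ F.symm ⁻¹' tsupport (φ n) := by
    intro n
    have h1 := tsupport_comp_subset (g := F.linear) (map_zero _)
      (φ n ∘ (affineHomeo F.symm))
    rw [tsupport_comp_eq_preimage] at h1
    exact h1
  refine ⟨h1.piola F, fun n => StokesFE.piola F (φ n), fun n =>
    ⟨contDiff_piola F (hφ n).1, ?_, ?_⟩, ?_⟩
  · exact ((hφ n).2.1.comp_homeomorph (affineHomeo F.symm)).comp_left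
      (g := F.linear) (map_zero _)
  · intro x hx
    simpa using (hφ n).2.2 (hts n hx)
  · obtain ⟨α, hα⟩ := exists_entry_bound F
    obtain ⟨β, hβ⟩ := exists_entry_bound F.symm
    have hle : ∀ n, h1Norm D (StokesFE.piola F v - StokesFE.piola F (φ n)) ≤
        Real.sqrt (absDet F * ((9 * α ^ 2 + 81 * (α ^ 2 * β ^ 2)) *
          h1Norm (F ⁻¹' D) (v - φ n) ^ 2)) := by
      intro n
      refine Real.le_sqrt_of_sq_le ?_
      have e : StokesFE.piola F v - StokesFE.piola F (φ n) = StokesFE.piola F (v - φ n) := by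
        funext x
        simp [StokesFE.piola]
      rw [e]
      exact h1Norm_piola_sq_le F hD (h1.sub (memH1_of_contDiff hb (hφ n).1)) hα hβ
    refine squeeze_zero (fun n => h1Norm_nonneg) hle ?_
    have := (Real.continuous_sqrt.tendsto _).comp
      (((hlim.pow 2).const_mul (9 * α ^ 2 + 81 * (α ^ 2 * β ^ 2))).const_mul (absDet F))
    simpa [Function.comp_def] using this

end Affine

/-! ### Geometry of tetrahedra -/

section Geometry

variable (K K' : Tet)

lemma body_eq : body K = {x | ∀ i, 0 ≤ bary K i x} :=
  (affBasis K).convexHull_eq_nonneg_coord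

lemma dom_eq : dom K = {x | ∀ i, 0 < bary K i x} :=
  (affBasis K).interior_convexHull

lemma isOpen_dom : IsOpen (dom K) := isOpen_interior

lemma isCompact_body : IsCompact (body K) := (Set.finite_range K.points).isCompact_convexHull ℝ

lemma dom_subset_body : dom K ⊆ body K := interior_subset

lemma isBounded_dom : Bornology.IsBounded (dom K) :=
  (isCompact_body K).isBounded.subset (dom_subset_body K)

lemma dom_ae_eq_body : dom K =ᵐ[volume] body K :=
  interior_ae_eq_of_null_frontier ((convex_convexHull ℝ _).addHaar_frontier volume)

lemma restrict_body : volume.restrict (body K) = volume.restrict (dom K) :=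
  (Measure.restrict_congr_set (dom_ae_eq_body K)).symm

lemma dom_nonempty : (dom K).Nonempty := by
  refine ⟨K.centroid, ?_⟩
  rw [dom_eq]
  intro i
  have := (affBasis K).coord_apply_centroid (s := Finset.univ) (i := i) (Finset.mem_univ i)
  change 0 < (affBasis K).coord i (Finset.univ.centroid ℝ (affBasis K))
  rw [this]
  simp

lemma volume_real_dom_pos : 0 < volume.real (dom K) :=
  ENNReal.toReal_pos ((isOpen_dom K).measure_pos volume (dom_nonempty K)).ne'
    (isBounded_dom K).measure_lt_top.ne

lemma sum_bary (x : E3) : ∑ i, bary K i x = 1 := (affBasis K).sum_coord_apply_eq_one x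

lemma sum_bary_smul (x : E3) : ∑ i, bary K i x • K.points i = x :=
  (affBasis K).linear_combination_coord_eq_self x

/-- The weights of an affine combination of the vertices are its barycentric coordinates. -/
lemma bary_sum_smul {w : Fin 4 → ℝ} (hw : ∑ i, w i = 1) (i : Fin 4) :
    bary K i (∑ j, w j • K.points j) = w i := by
  have h := (affBasis K).coord_apply_combination_of_mem (Finset.mem_univ i) hw
  rwa [Finset.affineCombination_eq_linear_combination _ _ _ hw] at h

/-- The affine map taking the vertices of `K` to those of `K'`. -/
noncomputable def matchMap : E3 →ᵃ[ℝ] E3 :=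
  ∑ i, (LinearMap.toSpanSingleton ℝ E3 (K'.points i)).toAffineMap.comp (bary K i)

lemma matchMap_apply (x : E3) : matchMap K K' x = ∑ i, bary K i x • K'.points i := by
  simp [matchMap, Fin.sum_univ_four]

lemma bary_matchMap (x : E3) (i : Fin 4) : bary K' i (matchMap K K' x) = bary K i x := by
  rw [matchMap_apply, bary_sum_smul K' (sum_bary K x)]

lemma matchMap_matchMap (x : E3) : matchMap K' K (matchMap K K' x) = x := by
  rw [matchMap_apply K' K]
  simp only [bary_matchMap, sum_bary_smul]

/-- The affine equivalence taking the vertices of `K` to those of `K'`. -/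
noncomputable def matchEquiv : E3 ≃ᵃ[ℝ] E3 :=
  AffineEquiv.ofBijective (φ := matchMap K K') (Function.bijective_iff_has_inverse.2
    ⟨matchMap K' K, matchMap_matchMap K K', matchMap_matchMap K' K⟩)

lemma matchEquiv_apply (x : E3) : matchEquiv K K' x = matchMap K K' x := rfl

lemma bary_matchEquiv (x : E3) (i : Fin 4) : bary K' i (matchEquiv K K' x) = bary K i x :=
  bary_matchMap K K' x i

lemma matchEquiv_points (i : Fin 4) : matchEquiv K K' (K.points i) = K'.points i := by
  rw [matchEquiv_apply, matchMap_apply]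
  have h : ∀ j, bary K j (K.points i) = if j = i then 1 else 0 := fun j =>
    (affBasis K).coord_apply j i
  simp [h]

lemma matchEquiv_preimage_dom : matchEquiv K K' ⁻¹' dom K' = dom K := by
  ext x
  simp [dom_eq, bary_matchEquiv]

lemma matchEquiv_preimage_body : matchEquiv K K' ⁻¹' body K' = body K := by
  ext x
  simp [body_eq, bary_matchEquiv]

lemma centroid_eq_sum : K.centroid = ∑ i, (4 : ℝ)⁻¹ • K.points i := by
  rw [Affine.Simplex.centroid_eq_affineCombination,
    Finset.affineCombination_eq_linear_combination _ _ _
      (Finset.sum_centroidWeights_eq_one_of_nonempty ℝ _ Finset.univ_nonempty)]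
  simp [Finset.centroidWeights]

lemma matchEquiv_centroid : matchEquiv K K' K.centroid = K'.centroid := by
  rw [matchEquiv_apply, matchMap_apply, centroid_eq_sum K, centroid_eq_sum K']
  refine Finset.sum_congr rfl fun i _ => ?_
  rw [bary_sum_smul K (w := fun _ => 4⁻¹) (by simp)]

/-- The vertices of the regular tetrahedron inscribed in the cube `[-1, 1]³`. -/
noncomputable def regularVertex : Fin 4 → E3 :=
  ![!₂[1, 1, 1], !₂[1, -1, -1], !₂[-1, 1, -1], !₂[-1, -1, 1]]

lemma affineIndependent_regularVertex : AffineIndependent ℝ regularVertex := by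
  rw [affineIndependent_iff]
  intro s w hw hsum i hi
  classical
  -- extend the weights by zero
  let u : Fin 4 → ℝ := fun i => if i ∈ s then w i else 0
  have hu : ∑ i, u i = 0 := by simpa [u, Finset.sum_ite_mem] using hw
  have hv : ∑ i, u i • regularVertex i = 0 := by
    simpa [u, ite_smul, Finset.sum_ite_mem] using hsum
  have h0 := congrArg (fun x : E3 => x 0) hv
  have h1 := congrArg (fun x : E3 => x 1) hv
  have h2 := congrArg (fun x : E3 => x 2) hv
  simp [Fin.sum_univ_four, regularVertex] at h0 h1 h2
  rw [Fin.sum_univ_four] at hu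
  have : u i = 0 := by fin_cases i <;> (simp; linarith)
  simpa [u, hi] using this

/-- The regular tetrahedron inscribed in the cube `[-1, 1]³`; its barycenter is the origin. -/
noncomputable def regularTet : Tet := ⟨regularVertex, affineIndependent_regularVertex⟩

lemma centroid_regularTet : regularTet.centroid = 0 := by
  rw [centroid_eq_sum]
  ext i
  fin_cases i <;> simp [Fin.sum_univ_four, regularTet, regularVertex]

/-- The barycentric coordinates of the regular tetrahedron. -/
lemma bary_regularTet (x : E3) :
    bary regularTet 0 x = (1 + x 0 + x 1 + x 2) / 4 ∧
    bary regularTet 1 x = (1 + x 0 - x 1 - x 2) / 4 ∧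
    bary regularTet 2 x = (1 - x 0 + x 1 - x 2) / 4 ∧
    bary regularTet 3 x = (1 - x 0 - x 1 + x 2) / 4 := by
  let w : Fin 4 → ℝ := ![(1 + x 0 + x 1 + x 2) / 4, (1 + x 0 - x 1 - x 2) / 4,
    (1 - x 0 + x 1 - x 2) / 4, (1 - x 0 - x 1 + x 2) / 4]
  have hw : ∑ i, w i = 1 := by simp [w, Fin.sum_univ_four]; ring
  have hx : x = ∑ i, w i • regularTet.points i := by
    ext i
    fin_cases i <;> simp [Fin.sum_univ_four, regularTet, regularVertex, w] <;> ring
  have h := fun i => bary_sum_smul regularTet hw i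
  rw [← hx] at h
  exact ⟨h 0, h 1, h 2, h 3⟩

lemma exists_bary_eq_zero_of_mem_frontier {x : E3} (hx : x ∈ frontier (dom K)) :
    ∃ i, bary K i x = 0 := by
  have h1 : x ∈ body K :=
    closure_minimal (dom_subset_body K) (isCompact_body K).isClosed hx.1
  have h2 : x ∉ dom K := by rw [← (isOpen_dom K).interior_eq]; exact hx.2
  rw [body_eq] at h1
  rw [dom_eq, Set.mem_ofPred_eq, not_forall] at h2
  obtain ⟨i, hi⟩ := h2
  exact ⟨i, le_antisymm (not_lt.1 hi) (h1 i)⟩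

/-- The linear part of an affine map that takes a ball of radius `r` into a bounded set has norm
at most the diameter of the set divided by the diameter of the ball. -/
lemma abs_entry_le {F : E3 ≃ᵃ[ℝ] E3} {S T : Set E3} {c : E3} {r : ℝ} (hr : 0 < r)
    (hball : Metric.closedBall c r ⊆ S) (hFS : ∀ x ∈ S, F x ∈ T) (hT : Bornology.IsBounded T)
    (i l : Fin 3) : |entry F i l| ≤ Metric.diam T / (2 * r) := by
  set e : E3 := EuclideanSpace.single l 1 with he
  have hn : ‖e‖ = 1 := by simp [he]
  have hm : ∀ t : ℝ, |t| ≤ r → F (c + t • e) ∈ T := fun t ht =>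
    hFS _ (hball (by simpa [norm_smul, hn] using ht))
  have hd := Metric.dist_le_diam_of_mem hT (hm r (abs_of_pos hr).le)
    (hm (-r) (by rw [abs_neg, abs_of_pos hr]))
  have hF : F (c + r • e) - F (c + (-r) • e) = (2 * r) • F.linear e := by
    rw [affineEquiv_apply F, affineEquiv_apply F (c + (-r) • e)]
    simp only [map_add, map_smul]
    module
  rw [dist_eq_norm, hF, norm_smul, Real.norm_of_nonneg (by positivity)] at hd
  rw [le_div_iff₀ (by positivity), mul_comm]
  refine le_trans (mul_le_mul_of_nonneg_left ?_ (by positivity)) hd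
  exact PiLp.norm_apply_le (F.linear e) i

end Geometry

/-! ### Polynomial functions and affine substitutions -/

section PolynomialFunctions

open MvPolynomial

variable (F : E3 ≃ᵃ[ℝ] E3) {k m : ℕ}

lemma mem_polySpace {q : E3 → ℝ} :
    q ∈ polySpace k ↔ ∃ p : MvPolynomial (Fin 3) ℝ, p.totalDegree ≤ k ∧
      ∀ x, q x = eval (fun i => x i) p := by
  constructor
  · rintro ⟨p, hp, rfl⟩
    exact ⟨p, (mem_restrictTotalDegree _ _ _).1 hp, fun x => by simp [polyFun]⟩
  · rintro ⟨p, hp, hq⟩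
    exact ⟨p, (mem_restrictTotalDegree _ _ _).2 hp, by funext x; simp [polyFun, hq]⟩

lemma eval_mem_polySpace {p : MvPolynomial (Fin 3) ℝ} (hp : p.totalDegree ≤ k) :
    (fun x : E3 => eval (fun i => x i) p) ∈ polySpace k :=
  mem_polySpace.2 ⟨p, hp, fun _ => rfl⟩

lemma totalDegree_aeval_le {p : MvPolynomial (Fin 3) ℝ} (hp : p.totalDegree ≤ k)
    {g : Fin 3 → MvPolynomial (Fin 3) ℝ} (hg : ∀ i, (g i).totalDegree ≤ 1) :
    (aeval g p).totalDegree ≤ k := by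
  rw [aeval_def, eval₂_eq]
  refine totalDegree_finsetSum_le fun d hd => ?_
  have h1 : (∏ i ∈ d.support, g i ^ d i).totalDegree ≤ k := by
    refine (totalDegree_finsetProd _ _).trans ?_
    refine le_trans (Finset.sum_le_sum fun i _ => ?_) ((le_totalDegree hd).trans hp)
    exact (totalDegree_pow _ _).trans (by simpa using Nat.mul_le_mul_left (d i) (hg i))
  refine (totalDegree_mul _ _).trans ?_
  rw [algebraMap_eq, totalDegree_C, zero_add]
  exact h1

/-- The `i`-th coordinate of an affine map, as a polynomial. -/
noncomputable def coordPoly (i : Fin 3) : MvPolynomial (Fin 3) ℝ :=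
  (∑ l, C (entry F i l) * X l) + C (F 0 i)

lemma totalDegree_coordPoly (i : Fin 3) : (coordPoly F i).totalDegree ≤ 1 := by
  refine (totalDegree_add _ _).trans (max_le (totalDegree_finsetSum_le fun l _ => ?_) (by simp))
  refine (totalDegree_mul _ _).trans ?_
  simp

lemma eval_aeval (g : Fin 3 → MvPolynomial (Fin 3) ℝ) (p : MvPolynomial (Fin 3) ℝ) (x : Fin 3 → ℝ) :
    eval x (aeval g p) = eval (fun i => eval x (g i)) p := by
  induction p using MvPolynomial.induction_on with
  | C a => simp
  | add p q hp hq => simp only [map_add, hp, hq]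
  | mul_X p i hp => simp only [map_mul, aeval_X, eval_X, hp]

lemma eval_coordPoly (x : E3) (i : Fin 3) : eval (fun j => x j) (coordPoly F i) = F x i := by
  rw [affineEquiv_apply F x, PiLp.add_apply, linear_apply_eq_sum]
  simp [coordPoly]

/-- Polynomial functions of degree at most `k` are preserved by affine substitutions. -/
lemma comp_affineEquiv_mem_polySpace {q : E3 → ℝ} (hq : q ∈ polySpace k) :
    (fun x => q (F x)) ∈ polySpace k := by
  obtain ⟨p, hp, hq⟩ := mem_polySpace.1 hq
  refine mem_polySpace.2 ⟨aeval (coordPoly F) p,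
    totalDegree_aeval_le hp (totalDegree_coordPoly F), fun x => ?_⟩
  rw [hq, eval_aeval]
  simp only [eval_coordPoly]

/-- Homogeneous polynomials in coordinates centred at the origin become homogeneous in the
coordinates centred at the point that is taken to the origin. -/
lemma eval_comp_mem_homSpace {a : E3} (ha : F a = 0) {p : MvPolynomial (Fin 3) ℝ}
    (hp : p.IsHomogeneous m) : (fun x => eval (fun i => F x i) p) ∈ homSpace a m := by
  let g : Fin 3 → MvPolynomial (Fin 3) ℝ := fun i => ∑ l, C (entry F i l) * X l
  have hg : ∀ i, (g i).IsHomogeneous 1 := fun i =>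
    IsHomogeneous.sum _ _ _ fun l _ => isHomogeneous_C_mul_X _ _
  refine ⟨aeval g p, by simpa using hp.aeval g hg, ?_⟩
  funext x
  have hx : ∀ i, F x i = eval (fun j => x j - a j) (g i) := by
    intro i
    have h := linear_apply_eq_sum F (x - a) i
    rw [map_sub, show F.linear x - F.linear a = F x - F a by
      rw [affineEquiv_apply F x, affineEquiv_apply F a]; abel, ha, sub_zero] at h
    rw [h]
    simp [g]
  simp only [polyFun, LinearMap.coe_mk, AddHom.coe_mk, eval_aeval, hx]

lemma piola_mem_vecPolySpace {v : E3 → E3} (hv : v ∈ vecPolySpace k) :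
    piola F v ∈ vecPolySpace k := by
  intro i
  have e : (fun x => piola F v x i) = ∑ l, entry F i l • fun x => v (F.symm x) l := by
    funext x
    rw [piola, linear_apply_eq_sum]
    simp [Finset.sum_apply]
  rw [e]
  exact sum_mem fun l _ => (polySpace k).smul_mem _ (comp_affineEquiv_mem_polySpace F.symm (hv l))

lemma contDiff_eval (p : MvPolynomial (Fin 3) ℝ) :
    ContDiff ℝ ∞ fun x : E3 => eval (fun i => x i) p := by
  induction p using MvPolynomial.induction_on with
  | C a => simpa using contDiff_const
  | add p q hp hq => simpa using hp.add hq
  | mul_X p l hp =>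
    simpa using hp.mul ((EuclideanSpace.proj l : E3 →L[ℝ] ℝ).contDiff)

lemma partialDeriv_eval (j : Fin 3) (p : MvPolynomial (Fin 3) ℝ) (x : E3) :
    partialDeriv j (fun x : E3 => eval (fun i => x i) p) x = eval (fun i => x i) (pderiv j p) := by
  classical
  have hd : ∀ p, DifferentiableAt ℝ (fun x : E3 => eval (fun i => x i) p) x := fun p =>
    (contDiff_eval p).differentiable (by simp) x
  induction p using MvPolynomial.induction_on with
  | C a => simp [partialDeriv]
  | add p q hp hq =>
    simp only [map_add, ← hp, ← hq, partialDeriv, fderiv_fun_add (hd p) (hd q),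
      add_apply]
  | mul_X p l hp =>
    have hl : partialDeriv j (fun x : E3 => x l) x = Pi.single (M := fun _ => ℝ) j 1 l := by
      rw [partialDeriv, show (fun x : E3 => x l) = (EuclideanSpace.proj l : E3 →L[ℝ] ℝ) from rfl,
        ContinuousLinearMap.fderiv]
      simp [Pi.single_apply]
    have h := partialDeriv_mul (hd p) (g := fun x : E3 => x l)
      ((EuclideanSpace.proj l : E3 →L[ℝ] ℝ).differentiableAt) j
    simp only [map_mul, eval_X]
    rw [h, hp, hl, pderiv_mul, pderiv_X]
    rcases eq_or_ne l j with rfl | hne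
    · simp; ring
    · simp [hne]; ring

lemma continuous_of_mem_polySpace {q : E3 → ℝ} (hq : q ∈ polySpace k) : Continuous q := by
  obtain ⟨p, -, hp⟩ := mem_polySpace.1 hq
  rw [show q = fun x : E3 => eval (fun i => x i) p from funext hp]
  exact (contDiff_eval p).continuous

/-- The polynomial vector field with given components. -/
noncomputable def polyField (W : Fin 3 → MvPolynomial (Fin 3) ℝ) (x : E3) : E3 :=
  WithLp.toLp 2 fun i => eval (fun j => x j) (W i)

lemma contDiff_polyField (W : Fin 3 → MvPolynomial (Fin 3) ℝ) : ContDiff ℝ ∞ (polyField W) :=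
  contDiff_euclidean.2 fun i => contDiff_eval (W i)

/-- The bubble polynomial is a multiple of the product of the barycentric coordinates. -/
lemma eval_bubblePoly (x : E3) :
    eval (fun i => x i) bubblePoly = 256 * ∏ i, bary regularTet i x := by
  obtain ⟨h0, h1, h2, h3⟩ := bary_regularTet x
  rw [Fin.prod_univ_four, h0, h1, h2, h3]
  simp [bubblePoly, normSq, bubbleCubic, bubbleQuartic]
  ring

/-- On the regular tetrahedron, the fields `bubblePoly * W` vanish on the boundary. -/
lemma memH10_polyField_bubble (W : Fin 3 → MvPolynomial (Fin 3) ℝ) :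
    MemH10 (dom regularTet) (polyField fun i => bubblePoly * W i) := by
  have h := memH10_smul_of_frontier (isOpen_dom regularTet) (isBounded_dom regularTet)
    (contDiff_eval bubblePoly) (contDiff_polyField W) (fun x hx => ?_) (fun x hx => ?_)
  · convert h using 1
    funext x
    ext i
    simp [polyField]
  · rw [dom_eq] at hx
    rw [eval_bubblePoly]
    exact mul_pos (by norm_num) (Finset.prod_pos fun i _ => hx i)
  · obtain ⟨i, hi⟩ := exists_bary_eq_zero_of_mem_frontier _ hx
    rw [eval_bubblePoly, Finset.prod_eq_zero (Finset.mem_univ i) hi, mul_zero]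

lemma weakDiv_polyField {D : Set E3} (hD : IsOpen D) (hb : Bornology.IsBounded D)
    (W : Fin 3 → MvPolynomial (Fin 3) ℝ) :
    ∀ᵐ x ∂(volume.restrict D),
      weakDiv D (polyField W) x = eval (fun i => x i) (∑ i, pderiv i (W i)) := by
  filter_upwards [(isWeakJacobian_jacobian hb (contDiff_polyField W)).weakDiv_ae_eq hD] with x hx
  rw [hx, map_sum]
  exact Finset.sum_congr rfl fun i _ => partialDeriv_eval i (W i) x

lemma totalDegree_bubblePoly_le : bubblePoly.totalDegree ≤ 4 := by
  have h1 : (2 * normSq).totalDegree ≤ 2 := by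
    have := (isHomogeneous_normSq.C_mul 2).totalDegree_le
    rwa [map_ofNat] at this
  refine (totalDegree_add _ _).trans (max_le ((totalDegree_add _ _).trans
    (max_le ((totalDegree_sub _ _).trans (max_le (by simp) (by omega)))
      (isHomogeneous_bubbleCubic.totalDegree_le.trans (by norm_num))))
      isHomogeneous_bubbleQuartic.totalDegree_le)

/-- The decomposition of polynomials on the reference element: a divergence of a bubble field,
an element of `S_M`, and a constant. -/
lemma exists_decomposition {M : ℕ} (hM : 1 ≤ M) {Q : MvPolynomial (Fin 3) ℝ}
    (hQ : Q.totalDegree ≤ M) :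
    ∃ (W : Fin 3 → MvPolynomial (Fin 3) ℝ) (U : MvPolynomial (Fin 3) ℝ) (c : ℝ),
      (∀ i, (bubblePoly * W i).totalDegree ≤ M + 1) ∧
      (U ∈ if M = 1 then homogeneousSubmodule (Fin 3) ℝ 1
        else homogeneousSubmodule (Fin 3) ℝ M ⊔ homogeneousSubmodule (Fin 3) ℝ (M - 1)) ∧
      Q = ∑ i, pderiv i (bubblePoly * W i) + U + C c := by
  rcases lt_or_ge M 3 with h3 | h3
  · have hsum := sum_homogeneousComponent Q
    have hz : ∀ n, M < n → homogeneousComponent n Q = 0 := fun n hn =>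
      homogeneousComponent_eq_zero n Q (by omega)
    have hsum' : Q = ∑ n ∈ Finset.range 3, homogeneousComponent n Q := by
      conv_lhs => rw [← hsum]
      refine Finset.sum_subset (fun n hn => ?_) fun n _ hn => ?_
      · have := Finset.mem_range.1 hn
        exact Finset.mem_range.2 (by omega)
      · exact homogeneousComponent_eq_zero n Q (by
          have := mt Finset.mem_range.2 hn; omega)
    refine ⟨0, homogeneousComponent 1 Q + homogeneousComponent 2 Q, coeff 0 Q, by simp, ?_, ?_⟩
    · obtain rfl | rfl : M = 1 ∨ M = 2 := by omega
      · rw [if_pos rfl, hz 2 (by norm_num), add_zero]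
        exact homogeneousComponent_isHomogeneous 1 Q
      · rw [if_neg (by norm_num), add_comm]
        exact Submodule.add_mem_sup (homogeneousComponent_isHomogeneous 2 Q)
          (homogeneousComponent_isHomogeneous 1 Q)
    · rw [← homogeneousComponent_zero]
      conv_lhs => rw [hsum']
      simp [Finset.sum_range_succ]
      ring
  · obtain ⟨y, hy, z, hz, rfl⟩ := Submodule.mem_sup.1 (mem_attainable_of_totalDegree_le hQ)
    obtain ⟨d, hd, U, hU, rfl⟩ := Submodule.mem_sup.1 hy
    obtain ⟨c, rfl⟩ := Submodule.mem_span_singleton.1 hz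
    have hW : ∃ W : Fin 3 → MvPolynomial (Fin 3) ℝ, (∀ i, (W i).totalDegree ≤ M - 3) ∧
        d = ∑ i, pderiv i (bubblePoly * W i) := by
      clear hQ hy
      induction hd using Submodule.span_induction with
      | mem q hq =>
        obtain ⟨i, p, hp, rfl⟩ := hq
        refine ⟨Pi.single i p, fun j => ?_, ?_⟩
        · rcases eq_or_ne j i with rfl | h
          · simpa using hp
          · simp [h]
        · rw [Finset.sum_eq_single i]
          · simp
          · intro j _ hj; simp [hj]
          · simp
      | zero => exact ⟨0, by simp, by simp⟩
      | add p q _ _ hp hq =>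
        obtain ⟨W, h1, rfl⟩ := hp
        obtain ⟨W', h1', rfl⟩ := hq
        exact ⟨W + W', fun i => (totalDegree_add _ _).trans (max_le (h1 i) (h1' i)),
          by simp only [Pi.add_apply, mul_add, map_add, Finset.sum_add_distrib]⟩
      | smul a p _ hp =>
        obtain ⟨W, h1, rfl⟩ := hp
        refine ⟨a • W, fun i => (totalDegree_smul_le _ _).trans (h1 i), ?_⟩
        simp only [Pi.smul_apply, mul_smul_comm, Derivation.map_smul, Finset.smul_sum]
    obtain ⟨W, hW1, rfl⟩ := hW
    refine ⟨W, U, c, fun i => (totalDegree_mul _ _).trans ?_, ?_, ?_⟩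
    · have := totalDegree_bubblePoly_le
      have := hW1 i
      omega
    · rw [if_neg (by omega)]
      exact hU
    · rw [smul_eq_C_mul, mul_one]

end PolynomialFunctions

/-! ### Surjectivity of the divergence -/

section Surjectivity

open MvPolynomial

variable {k : ℕ} {K : Tet} {B : Submodule ℝ (E3 → E3)} {q : E3 → ℝ}

lemma integrable_dom_of_continuous {f : E3 → ℝ} (hf : Continuous f) :
    Integrable f (volume.restrict (dom K)) :=
  memLp_one_iff_integrable.1 (hf.memLp_restrict_of_isBounded (isBounded_dom K))

/-- A finite combination of the generators of a space of interior bubbles has any prescribed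
divergence in the mean-value-free version of `S_{k-1}(K)`. -/
lemma IsInteriorBubbleSpace.exists_weakDiv_eq (hB : IsInteriorBubbleSpace k K B)
    (hq : q ∈ sRing (k - 1) K) :
    ∃ v ∈ B, MemH10 (dom K) v ∧ ∀ᵐ x ∂(volume.restrict (dom K)), weakDiv (dom K) v x = q x := by
  obtain ⟨N, β, g, -, hspan, hβ, hdiv, rfl⟩ := hB
  rw [← hspan] at hq
  obtain ⟨c, rfl⟩ := (Submodule.mem_span_range_iff_exists_fun ℝ).1 hq
  refine ⟨fun x => ∑ j, c j • β j x, ?_,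
    MemH10.sum c (isOpen_dom K) (isBounded_dom K) fun j => (hβ j).2, ?_⟩
  · have : (fun x => ∑ j, c j • β j x) = ∑ j, c j • β j := by
      funext x
      simp [Finset.sum_apply]
    rw [this]
    exact sum_mem fun j _ => Submodule.smul_mem _ _ (Submodule.subset_span ⟨j, rfl⟩)
  · filter_upwards [weakDiv_sum c (isOpen_dom K) fun j => (hβ j).2.1, ae_all_iff.2 hdiv]
      with x hx hx'
    rw [hx]
    simp [Finset.sum_apply, hx']

/-- For `k ≥ 2` every mean-value-free polynomial of degree at most `k - 1` is the divergence of
the sum of a polynomial bubble field and an interior bubble: up to the two top degrees and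
constants it is a divergence of polynomial bubble fields, and the constant is determined by the
divergence theorem. -/
theorem exists_weakDiv_eq (hk : 2 ≤ k) (hB : IsInteriorBubbleSpace k K B)
    (hq : q ∈ polySpace (k - 1)) (h0 : ∫ x in body K, q x = 0) :
    ∃ v ∈ vecPolySpace k ⊔ B, MemH10 (dom K) v ∧
      ∀ᵐ x ∂(volume.restrict (dom K)), weakDiv (dom K) v x = q x := by
  set F := matchEquiv regularTet K with hF
  have hpre : F ⁻¹' dom K = dom regularTet := matchEquiv_preimage_dom regularTet K
  have hcen : F.symm K.centroid = 0 := by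
    rw [AffineEquiv.symm_apply_eq, ← centroid_regularTet, matchEquiv_centroid]
  obtain ⟨Q, hQ, hqQ⟩ := mem_polySpace.1 (comp_affineEquiv_mem_polySpace F hq)
  obtain ⟨W, U, c, hW, hU, hdec⟩ := exists_decomposition (by omega) hQ
  -- the polynomial part
  set v₁ : E3 → E3 := piola F (polyField fun i => bubblePoly * W i) with hv₁
  have hv₁P : v₁ ∈ vecPolySpace k := by
    refine piola_mem_vecPolySpace F fun i => eval_mem_polySpace ((hW i).trans ?_)
    omega
  have hbub : MemH10 (F ⁻¹' dom K) (polyField fun i => bubblePoly * W i) :=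
    hpre ▸ memH10_polyField_bubble W
  have hv₁0 : MemH10 (dom K) v₁ :=
    MemH10.piola F (isOpen_dom K) (hpre ▸ isBounded_dom regularTet) hbub
  have hdiv₁ : ∀ᵐ x ∂(volume.restrict (dom K)), weakDiv (dom K) v₁ x =
      eval (fun i => F.symm x i) (∑ i, pderiv i (bubblePoly * W i)) := by
    have h1 := weakDiv_polyField (hpre ▸ isOpen_dom regularTet : IsOpen (F ⁻¹' dom K))
      (hpre ▸ isBounded_dom regularTet) fun i => bubblePoly * W i
    filter_upwards [weakDiv_piola F (isOpen_dom K) hbub.1, ae_comp_affineEquiv F h1] with x h2 h3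
    rw [h2, h3]
  -- the part in `S_{k-1}(K)`
  set u : E3 → ℝ := fun x => eval (fun i => F.symm x i) U with hu
  have huS : u ∈ sSpace (k - 1) K := by
    rw [sSpace]
    split_ifs at hU ⊢ with h
    · exact eval_comp_mem_homSpace F.symm hcen hU
    · obtain ⟨U₁, h₁, U₂, h₂, rfl⟩ := Submodule.mem_sup.1 hU
      have e : u = (fun x => eval (fun i => F.symm x i) U₁) +
          fun x => eval (fun i => F.symm x i) U₂ := by
        funext x
        simp [hu]
      rw [e]
      exact Submodule.add_mem_sup (eval_comp_mem_homSpace F.symm hcen h₁)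
        (eval_comp_mem_homSpace F.symm hcen h₂)
  obtain ⟨v₂, hv₂B, hv₂0, hdiv₂⟩ :=
    hB.exists_weakDiv_eq (q := fun x => u x - ⨍ y in body K, u y) ⟨u, huS, rfl⟩
  have hsum : (fun x => ∑ l, (![1, 1] : Fin 2 → ℝ) l • (![v₁, v₂] : Fin 2 → E3 → E3) l x) =
      v₁ + v₂ := by
    funext x
    simp
  have hall : ∀ l, MemH10 (dom K) ((![v₁, v₂] : Fin 2 → E3 → E3) l) := by
    intro l
    fin_cases l
    · exact hv₁0
    · exact hv₂0
  have hv0 := MemH10.sum ![1, 1] (isOpen_dom K) (isBounded_dom K) hall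
  have hdivs := weakDiv_sum ![1, 1] (isOpen_dom K) fun l => (hall l).1
  rw [hsum] at hv0 hdivs
  set μ : ℝ := ⨍ y in body K, u y with hμ
  have hdiv : ∀ᵐ x ∂(volume.restrict (dom K)), weakDiv (dom K) (v₁ + v₂) x = q x - (c + μ) := by
    filter_upwards [hdivs, hdiv₁, hdiv₂] with x h1 h2 h3
    have e := hqQ (F.symm x)
    rw [AffineEquiv.apply_symm_apply, hdec] at e
    rw [h1, e]
    simp only [Fin.sum_univ_two, Matrix.cons_val_zero, Matrix.cons_val_one, h2, h3, hu, map_add,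
      eval_C]
    ring
  -- the constant vanishes by the divergence theorem
  have hc : c + μ = 0 := by
    have h1 := hv0.integral_weakDiv_eq_zero (isOpen_dom K) (isBounded_dom K)
    have hfin : IsFiniteMeasure (volume.restrict (dom K)) :=
      ⟨by simpa using (isBounded_dom K).measure_lt_top⟩
    rw [integral_congr_ae hdiv, integral_sub
      (integrable_dom_of_continuous (continuous_of_mem_polySpace hq)) (integrable_const _),
      ← restrict_body, h0, restrict_body, zero_sub, neg_eq_zero, setIntegral_const, smul_eq_mul,
      mul_eq_zero] at h1
    exact h1.resolve_left (volume_real_dom_pos K).ne'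
  refine ⟨v₁ + v₂, Submodule.add_mem_sup hv₁P hv₂B, hv0, ?_⟩
  filter_upwards [hdiv] with x hx
  rw [hx, hc, sub_zero]

end Surjectivity

/-! ### The bound on a fixed element -/

section Bound

variable {k : ℕ} {K : Tet} {B : Submodule ℝ (E3 → E3)}

/-- The polynomials of degree at most `k - 1` with vanishing mean value on `K`. -/
def meanFree (k : ℕ) (K : Tet) : Submodule ℝ (E3 → ℝ) where
  carrier := {q | q ∈ polySpace (k - 1) ∧ ∫ x in body K, q x = 0}
  add_mem' := by
    rintro p q ⟨hp, hp0⟩ ⟨hq, hq0⟩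
    refine ⟨add_mem hp hq, ?_⟩
    rw [restrict_body] at *
    simp only [Pi.add_apply]
    rw [integral_add (integrable_dom_of_continuous (continuous_of_mem_polySpace hp))
      (integrable_dom_of_continuous (continuous_of_mem_polySpace hq)), hp0, hq0, add_zero]
  zero_mem' := ⟨zero_mem _, by simp⟩
  smul_mem' := by
    rintro c q ⟨hq, hq0⟩
    refine ⟨(polySpace (k - 1)).smul_mem c hq, ?_⟩
    simp only [Pi.smul_apply, smul_eq_mul]
    rw [integral_const_mul, hq0, mul_zero]

instance : FiniteDimensional ℝ (meanFree k K) := by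
  have : FiniteDimensional ℝ (polySpace (k - 1)) := by
    unfold polySpace
    infer_instance
  exact Submodule.finiteDimensional_of_le (S₂ := polySpace (k - 1)) fun q hq => hq.1

lemma memLp_of_mem_meanFree {q : E3 → ℝ} (hq : q ∈ meanFree k K) :
    MemLp q 2 (volume.restrict (dom K)) :=
  (continuous_of_mem_polySpace hq.1).memLp_restrict_of_isBounded (isBounded_dom K)

/-- The classes in `L²(K)` of the mean-value-free polynomials. -/
noncomputable def meanFreeToLp (k : ℕ) (K : Tet) :
    meanFree k K →ₗ[ℝ] Lp ℝ 2 (volume.restrict (dom K)) where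
  toFun q := (memLp_of_mem_meanFree q.2).toLp q.1
  map_add' p q := MemLp.toLp_add (memLp_of_mem_meanFree p.2) (memLp_of_mem_meanFree q.2)
  map_smul' c q := MemLp.toLp_const_smul c (memLp_of_mem_meanFree q.2)

lemma norm_toLp_eq_l2Norm {D : Set E3} {q : E3 → ℝ} (hq : MemLp q 2 (volume.restrict D)) :
    ‖hq.toLp q‖ = l2Norm D q := by
  rw [Lp.norm_toLp, hq.eLpNorm_eq_integral_rpow_norm (by norm_num) (by norm_num),
    ENNReal.toReal_ofReal (by positivity), l2Norm, Real.sqrt_eq_rpow]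
  simp

lemma h1Norm_sum_le {ι : Type*} [Fintype ι] {D : Set E3} {u : ι → E3 → E3} {c : ι → ℝ} {a : ℝ}
    (hD : IsOpen D) (h : ∀ l, MemH1 D (u l)) (ha : 0 ≤ a) (hc : ∀ l, |c l| ≤ a) :
    h1Norm D (fun x => ∑ l, c l • u l x) ≤
      a * Real.sqrt (Fintype.card ι * ∑ l, h1Norm D (u l) ^ 2) := by
  refine (pow_le_pow_iff_left₀ h1Norm_nonneg (by positivity) two_ne_zero).1 ?_
  refine (h1Norm_sum_sq_le c hD h).trans ?_
  rw [mul_pow, Real.sq_sqrt (by positivity), mul_left_comm]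
  refine mul_le_mul_of_nonneg_left ?_ (Nat.cast_nonneg _)
  rw [Finset.mul_sum]
  refine Finset.sum_le_sum fun l _ => ?_
  rw [← sq_abs (c l)]
  exact mul_le_mul_of_nonneg_right (pow_le_pow_left₀ (abs_nonneg _) (hc l) 2) (sq_nonneg _)

/-- On a fixed element the right inverse of the divergence can be bounded, since it is determined
by its values on a basis of a finite-dimensional subspace of `L²(K)`. -/
theorem exists_weakDiv_eq_h1Norm_le (hk : 2 ≤ k) (hB : IsInteriorBubbleSpace k K B) :
    ∃ C : ℝ, 0 ≤ C ∧ ∀ q ∈ polySpace (k - 1), ∫ x in body K, q x = 0 →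
      ∃ v ∈ vecPolySpace k ⊔ B, MemH10 (dom K) v ∧
        (∀ᵐ x ∂(volume.restrict (dom K)), weakDiv (dom K) v x = q x) ∧
        h1Norm (dom K) v ≤ C * l2Norm (dom K) q := by
  set T := meanFreeToLp k K with hT
  let b := Module.finBasis ℝ (LinearMap.range T)
  choose p hp using fun j => LinearMap.mem_range.1 (b j).2
  choose w hwB hw0 hwdiv using fun j => exists_weakDiv_eq hk hB (p j).2.1 (p j).2.2
  let L : LinearMap.range T →L[ℝ] (Fin (Module.finrank ℝ (LinearMap.range T)) → ℝ) :=
    LinearMap.toContinuousLinearMap b.equivFun.toLinearMap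
  set S : ℝ := Real.sqrt (Fintype.card (Fin (Module.finrank ℝ (LinearMap.range T))) *
    ∑ j, h1Norm (dom K) (w j) ^ 2) with hS
  refine ⟨‖L‖ * S, by positivity, fun q hq hq0 => ?_⟩
  let q' : meanFree k K := ⟨q, hq, hq0⟩
  let y : LinearMap.range T := ⟨T q', LinearMap.mem_range_self T q'⟩
  let c := L y
  have hcy : ∑ j, c j • b j = y := b.sum_equivFun y
  have hTq : T (∑ j, c j • p j) = T q' := by
    rw [map_sum]
    simp only [map_smul, hp]
    simpa using congrArg Subtype.val hcy
  have hae : ∀ᵐ x ∂(volume.restrict (dom K)), ∑ j, c j * (p j).1 x = q x := by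
    have h1 := (MemLp.toLp_eq_toLp_iff (memLp_of_mem_meanFree (∑ j, c j • p j).2)
      (memLp_of_mem_meanFree q'.2)).1 hTq
    filter_upwards [h1] with x hx
    rw [← show q'.1 x = q x from rfl, ← hx]
    simp [Finset.sum_apply]
  refine ⟨fun x => ∑ j, c j • w j x, ?_,
    MemH10.sum c (isOpen_dom K) (isBounded_dom K) hw0, ?_, ?_⟩
  · have : (fun x => ∑ j, c j • w j x) = ∑ j, c j • w j := by
      funext x
      simp [Finset.sum_apply]
    rw [this]
    exact sum_mem fun j _ => Submodule.smul_mem _ _ (hwB j)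
  · filter_upwards [weakDiv_sum c (isOpen_dom K) fun j => (hw0 j).1, ae_all_iff.2 hwdiv, hae]
      with x h1 h2 h3
    rw [h1, ← h3]
    exact Finset.sum_congr rfl fun j _ => by rw [h2 j]
  · have hy : ‖y‖ = l2Norm (dom K) q := norm_toLp_eq_l2Norm (memLp_of_mem_meanFree q'.2)
    have hc : ∀ j, |c j| ≤ ‖L‖ * l2Norm (dom K) q := fun j =>
      hy ▸ (norm_le_pi_norm c j).trans (L.le_opNorm y)
    have h := h1Norm_sum_le (isOpen_dom K) (fun j => (hw0 j).1)
      (mul_nonneg (norm_nonneg L) l2Norm_nonneg) hc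
    rwa [mul_right_comm]

end Bound

/-! ### Transfer from the reference element -/

section Transfer

variable {k : ℕ}

lemma le_velocitySpace (hk : 2 ≤ k) (β : Fin 4 → E3 → E3) (B : Submodule ℝ (E3 → E3)) :
    vecPolySpace k ⊔ B ≤ velocitySpace k β B := by
  rw [velocitySpace, if_neg (by omega)]
  split_ifs with h
  · subst h
    exact sup_le_sup_right le_sup_left _
  · exact le_rfl

/-- Under the Piola transform the constants on all shape-regular elements in a bounded set are
controlled by the one on the regular tetrahedron. -/
theorem exists_uniform_weakDiv_eq_h1Norm_le (hk : 2 ≤ k) {B : Tet → Submodule ℝ (E3 → E3)}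
    (hB : IsInteriorBubbleSpace k regularTet (B regularTet)) (hP : PiolaCompatible B)
    {Ω : Set E3} (hΩ : Bornology.IsBounded Ω) (σ : ℝ) :
    ∃ C : ℝ, 0 ≤ C ∧ ∀ K : Tet, body K ⊆ closure Ω → ShapeRegular σ K →
      ∀ q ∈ polySpace (k - 1), ∫ x in body K, q x = 0 →
      ∃ v ∈ vecPolySpace k ⊔ B K, MemH10 (dom K) v ∧
        (∀ᵐ x ∂(volume.restrict (dom K)), weakDiv (dom K) v x = q x) ∧
        h1Norm (dom K) v ≤ C * l2Norm (dom K) q := by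
  obtain ⟨C₀, hC₀, href⟩ := exists_weakDiv_eq_h1Norm_le hk hB
  obtain ⟨c₀, hc₀⟩ := dom_nonempty regularTet
  obtain ⟨r₀, hr₀, hball₀⟩ := Metric.nhds_basis_closedBall.mem_iff.1
    ((isOpen_dom regularTet).mem_nhds hc₀)
  have hball₀' := hball₀.trans (dom_subset_body regularTet)
  set d₀ := Metric.diam (body regularTet) with hd₀
  set d := Metric.diam (closure Ω) with hd
  set M : ℝ := 9 * (d / (2 * r₀)) ^ 2 + 81 * (σ * d₀ / (2 * r₀)) ^ 2 with hM
  refine ⟨C₀ * Real.sqrt M, by positivity, fun K hKΩ ⟨c, r, hr, hball, hσ⟩ q hq hq0 => ?_⟩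
  set F := matchEquiv regularTet K with hF
  have hpre : F ⁻¹' dom K = dom regularTet := matchEquiv_preimage_dom regularTet K
  have hpreb : F ⁻¹' body K = body regularTet := matchEquiv_preimage_body regularTet K
  have hq0' : ∫ x in body regularTet, q (F x) = 0 := by
    rw [setIntegral_affineEquiv F, hpreb, mul_eq_zero] at hq0
    exact hq0.resolve_left (absDet_pos F).ne'
  obtain ⟨w, hwB, hw0, hwdiv, hwn⟩ := href _ (comp_affineEquiv_mem_polySpace F hq) hq0'
  obtain ⟨w₁, hw₁, w₂, hw₂, rfl⟩ := Submodule.mem_sup.1 hwB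
  obtain ⟨v₂, hv₂, hv₂eq⟩ := hP regularTet K F.toAffineMap
    (matchEquiv_points regularTet K) w₂ hw₂
  -- on `K` the transformed field belongs to the velocity space
  have heq : ∀ x ∈ dom K, piola F (w₁ + w₂) x = (piola F w₁ + absDet F • v₂) x := by
    intro x hx
    have hx' : F.symm x ∈ body regularTet := by
      rw [← hpreb, Set.mem_preimage, AffineEquiv.apply_symm_apply]
      exact dom_subset_body K hx
    have h1 := hv₂eq _ hx'
    rw [AffineEquiv.coe_toAffineMap, AffineEquiv.apply_symm_apply] at h1
    have h2 : absDet F • v₂ x = F.linear (w₂ (F.symm x)) := by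
      rw [h1, smul_smul]
      change (absDet F * (absDet F)⁻¹) • F.linear (w₂ (F.symm x)) = _
      rw [mul_inv_cancel₀ (absDet_pos F).ne', one_smul]
    simp [piola, h2]
  rw [← hpre] at hw0 hwdiv hwn
  have hv0 : MemH10 (dom K) (piola F (w₁ + w₂)) :=
    MemH10.piola F (isOpen_dom K) (hpre ▸ isBounded_dom regularTet) hw0
  refine ⟨piola F w₁ + absDet F • v₂, Submodule.add_mem_sup (piola_mem_vecPolySpace F hw₁)
    ((B K).smul_mem _ hv₂), hv0.congr (isOpen_dom K) heq, ?_, ?_⟩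
  · rw [← weakDiv_congr (isOpen_dom K) heq]
    filter_upwards [weakDiv_piola F (isOpen_dom K) hw0.1, ae_comp_affineEquiv F hwdiv]
      with x h1 h2
    rw [h1, h2, AffineEquiv.apply_symm_apply]
  · rw [← h1Norm_congr (isOpen_dom K) heq]
    have hbK := (isCompact_body K).isBounded
    have hα := abs_entry_le hr₀ hball₀' (F := F) (T := body K)
      (fun x hx => by rwa [← hpreb] at hx) hbK
    have hβ := abs_entry_le hr hball (F := F.symm) (T := body regularTet)
      (fun x hx => by rw [← hpreb]; simpa using hx) (isCompact_body regularTet).isBounded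
    have hn := h1Norm_piola_sq_le F (isOpen_dom K) hw0.1 hα hβ
    have hdK : Metric.diam (body K) ≤ d := Metric.diam_mono hKΩ hΩ.closure
    have hdK0 : 0 ≤ Metric.diam (body K) := Metric.diam_nonneg
    have hd₀0 : 0 ≤ d₀ := Metric.diam_nonneg
    have hle : 9 * (Metric.diam (body K) / (2 * r₀)) ^ 2 + 81 *
        ((Metric.diam (body K) / (2 * r₀)) ^ 2 * (d₀ / (2 * r)) ^ 2) ≤ M := by
      rw [hM, ← mul_pow]
      refine add_le_add ?_ ?_
      · gcongr
      · have h1 : Metric.diam (body K) / (2 * r₀) * (d₀ / (2 * r)) ≤ σ * d₀ / (2 * r₀) := by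
          rw [div_mul_div_comm, div_le_div_iff₀ (by positivity) (by positivity)]
          have := mul_le_mul_of_nonneg_right hσ (by positivity : 0 ≤ d₀ * (2 * r₀))
          linarith
        have h0 : 0 ≤ Metric.diam (body K) / (2 * r₀) * (d₀ / (2 * r)) := by positivity
        gcongr
    have hM0 : 0 ≤ M := by positivity
    have hsq : h1Norm (dom K) (piola F (w₁ + w₂)) ^ 2 ≤
        (C₀ * Real.sqrt M * l2Norm (dom K) q) ^ 2 := by
      have hw2 := pow_le_pow_left₀ h1Norm_nonneg hwn 2
      calc h1Norm (dom K) (piola F (w₁ + w₂)) ^ 2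
          ≤ absDet F * (M * (C₀ * l2Norm (F ⁻¹' dom K) fun x => q (F x)) ^ 2) := by
            refine hn.trans (mul_le_mul_of_nonneg_left ?_ (absDet_pos F).le)
            exact mul_le_mul hle hw2 (sq_nonneg _) hM0
        _ = (C₀ * Real.sqrt M * l2Norm (dom K) q) ^ 2 := by
            rw [mul_pow (C₀ * Real.sqrt M), l2Norm_affineEquiv F, mul_pow C₀ (Real.sqrt M),
              Real.sq_sqrt hM0]
            ring
    have h3 : 0 ≤ l2Norm (dom K) q := l2Norm_nonneg
    exact (pow_le_pow_iff_left₀ h1Norm_nonneg (by positivity) two_ne_zero).1 hsq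

/-- For `k = 1` the only mean-value-free constant is zero. -/
lemma locallyOnto_one (K : Tet) (β : Fin 4 → E3 → E3) (B : Submodule ℝ (E3 → E3)) :
    LocallyOnto 1 0 K β B := by
  intro q hq hq0
  have hz : ∀ l : Fin 0, MemH10 (dom K) ((fun l => l.elim0 : Fin 0 → E3 → E3) l) := fun l => l.elim0
  have h1 := MemH10.sum (fun l => l.elim0) (isOpen_dom K) (isBounded_dom K) hz
  have h2 := weakDiv_sum (fun l => l.elim0) (isOpen_dom K) fun l => (hz l).1
  have h3 := h1Norm_sum_sq_le (fun l => l.elim0) (isOpen_dom K) fun l => (hz l).1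
  have e : (fun x => ∑ l : Fin 0, (l.elim0 : ℝ) • (fun l => l.elim0 : Fin 0 → E3 → E3) l x) =
      0 := by
    funext x
    simp
  rw [e] at h1 h2 h3
  obtain ⟨p, hp, hqp⟩ := mem_polySpace.1 hq
  obtain ⟨a, ha⟩ : ∃ a, p = MvPolynomial.C a :=
    ⟨_, MvPolynomial.totalDegree_eq_zero_iff_eq_C.1 (Nat.le_zero.1 hp)⟩
  simp only [ha, MvPolynomial.eval_C] at hqp
  simp only [hqp, restrict_body, setIntegral_const, smul_eq_mul] at hq0
  have ha0 : a = 0 := (mul_eq_zero.1 hq0).resolve_left (volume_real_dom_pos K).ne'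
  refine ⟨0, zero_mem _, h1, ?_, ?_⟩
  · filter_upwards [h2] with x hx
    rw [hx, hqp, ha0]
    simp
  · simp only [Finset.univ_eq_empty, Finset.sum_empty, mul_zero] at h3
    rw [zero_mul]
    exact (pow_eq_zero_iff two_ne_zero |>.1 (le_antisymm h3 (sq_nonneg _))).le

end Transfer

end StokesFE

theorem mainTheorem9 (k : ℕ) (hk : 1 ≤ k)
    (B : StokesFE.Tet → Submodule ℝ (StokesFE.E3 → StokesFE.E3))
    (hB : 2 ≤ k → ∀ K, StokesFE.IsInteriorBubbleSpace k K (B K)) :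
    (∀ K : StokesFE.Tet, ∃ C : ℝ, ∀ β : Fin 4 → StokesFE.E3 → StokesFE.E3,
      StokesFE.IsFaceBubbles K β → StokesFE.LocallyOnto k C K β (B K)) ∧
    (StokesFE.PiolaCompatible B →
      ∀ (Ω : Set StokesFE.E3), Bornology.IsBounded Ω → ∀ σ : ℝ, ∃ C : ℝ,
        ∀ K : StokesFE.Tet, StokesFE.body K ⊆ closure Ω → StokesFE.ShapeRegular σ K →
          ∀ β : Fin 4 → StokesFE.E3 → StokesFE.E3, StokesFE.IsFaceBubbles K β →
            StokesFE.LocallyOnto k C K β (B K)) := by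
  rcases hk.eq_or_lt with rfl | hk2
  · exact ⟨fun K => ⟨0, fun β _ => StokesFE.locallyOnto_one K β (B K)⟩,
      fun _ Ω _ σ => ⟨0, fun K _ _ β _ => StokesFE.locallyOnto_one K β (B K)⟩⟩
  · refine ⟨fun K => ?_, fun hP Ω hΩ σ => ?_⟩
    · obtain ⟨C, -, hC⟩ := StokesFE.exists_weakDiv_eq_h1Norm_le hk2 (hB hk2 K)
      refine ⟨C, fun β _ q hq hq0 => ?_⟩
      obtain ⟨v, hv, h⟩ := hC q hq hq0
      exact ⟨v, StokesFE.le_velocitySpace hk2 β (B K) hv, h⟩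
    · obtain ⟨C, -, hC⟩ := StokesFE.exists_uniform_weakDiv_eq_h1Norm_le hk2
        (hB hk2 StokesFE.regularTet) hP hΩ σ
      refine ⟨C, fun K hK hσ β _ q hq hq0 => ?_⟩
      obtain ⟨v, hv, h⟩ := hC K hK hσ q hq hq0
      exact ⟨v, StokesFE.le_velocitySpace hk2 β (B K) hv, h⟩
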